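/- A fork-join queueing network with blocking (FJQN/B) $N=(V,E)$ is a finite connected directed acyclic graph. Its nodes are single FCFS servers. Every arc carries a buffer of the same size $b\ge 1$, empty at time $0$. Each service consumes one job from every incoming buffer and adds one job to every outgoing buffer, and a service can start only if no incoming buffer is empty and no outgoing buffer is full. With $S_{m,v}\ge 0$ the $m$-th service time at $v$ ($m=0,1,2,\dots$), the service completion times are given by $$T_{m,v}=S_{m,v}+\max\big(\{T_{m,u}:(u,v)\in E\}\cup\{T_{m-1,v}: m\ge 1\}\cup\{T_{m-b,w}:(v,w)\in E,\ m\ge b\}\big),\qquad \max\emptyset=0.$$ The throughput is $\theta(N)=\mathbb{E}\big[(\lim_{m\to\infty}T_{m,v}/m)^{-1}\big]$, where the limit exists almost surely and the value does not depend on $v$. The degree $D(N)$ is the largest total number of (in and out) arcs at a node. The minimum level $L^*(N)$ is the minimum, over labellings $l:V\to\mathbb{Z}$ with $l(v)-l(u)\ge 1$ for all $(u,v)\in E$, of $\max_{(u,v)\in E}(l(v)-l(u))$. Let $\mathcal N=\{N_i\}_{i\ge1}$, $N_i=(V_i,E_i)$, be a sequence of FJQN/Bs with common buffer size $b$ and $\limsup_i|V_i|=\infty$.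 Its extended metric dimension $\dim_{EM}(\mathcal N)$ is the minimum integer $k$ (or $\infty$ if there is none) for which there is a constant $\Lambda$ such that for every $i$ there are $k_i\le k$ sets $W_1,\dots,W_{k_i}\subseteq V_i$ for which each vector of distances $\big(dis(v,W_1),\dots,dis(v,W_{k_i})\big)$, in the undirected counterpart of $N_i$, is shared by at most $\Lambda$ nodes $v\in V_i$. **Theorem 3.** Suppose that $$\limsup_{i\to\infty}D(N_i)<\infty\quad\text{and}\quad\limsup_{i\to\infty}L^*(N_i)<\infty,$$ that in each network the service times are i.i.d. with a distribution function $F_\sigma$ on $[0,\infty)$ that does not depend on $i$, and that for some integer $K\ge1$ $$\int_0^\infty\big(1-F_\sigma(x)\big)^{1/K}\,dx<\infty\quad\text{and}\quad\dim_{EM}(\mathcal N)\le K-1.$$ Then $\mathcal N$ is throughput scalable, that is, $\liminf_{i\to\infty}\theta(N_i)>0$. -/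

import Mathlib

open Filter Topology MeasureTheory ProbabilityTheory
open scoped ENNReal

/-- A fork-join queueing network with blocking on the node set `V`: a directed graph without
multiple arcs that is acyclic and (weakly) connected. The common buffer size is a separate
parameter. -/
structure FJQN (V : Type*) where
  /-- `Arc u v`: there is an arc from `u` to `v`. -/
  Arc : V → V → Prop
  acyclic : ∀ v, ¬ Relation.TransGen Arc v v
  connected : (SimpleGraph.fromRel Arc).Connected

namespace FJQN

section Network

variable {V : Type*}

/-- The undirected counterpart of the network. -/
def graph (N : FJQN V) : SimpleGraph V := SimpleGraph.fromRel N.Arc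

/-- The total number of arcs (in and out) connected to `v`. -/
noncomputable def deg (N : FJQN V) (v : V) : ℕ :=
  {u | N.Arc u v}.ncard + {w | N.Arc v w}.ncard

/-- The network degree. -/
noncomputable def networkDegree [Fintype V] (N : FJQN V) : ℕ := Finset.univ.sup N.deg

/-- A topological labelling: the label goes up by at least one along each arc. -/
def IsTopologicalLabelling (N : FJQN V) (l : V → ℤ) : Prop :=
  ∀ u v, N.Arc u v → 1 ≤ l v - l u

/-- The minimum level: the least `c` such that some topological labelling has all its
increments along arcs at most `c`, i.e. the minimum over topological labellings of the maximal
increment (`0` if there are no arcs). -/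
noncomputable def minLevel (N : FJQN V) : ℕ :=
  sInf {c : ℕ | ∃ l : V → ℤ, N.IsTopologicalLabelling l ∧ ∀ u v, N.Arc u v → l v - l u ≤ c}

/-- The arcs of the precedence graph with buffer size `b`: `N.Prec b y x` says that there is an
arc from `x` to `y`, i.e. that the service `x = (m, v)` has to wait for the end of the
service `y`. -/
def Prec (N : FJQN V) (b : ℕ+) (y x : ℕ × V) : Prop :=
  (N.Arc y.2 x.2 ∧ y.1 = x.1) ∨ (y.2 = x.2 ∧ y.1 + 1 = x.1) ∨
    (N.Arc x.2 y.2 ∧ y.1 + (b : ℕ) = x.1)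

theorem wellFounded_arc [Finite V] (N : FJQN V) : WellFounded N.Arc := by
  have : Std.Irrefl (Relation.TransGen N.Arc) := ⟨N.acyclic⟩
  have h : WellFounded (Relation.TransGen N.Arc) :=
    Finite.wellFounded_of_trans_of_irrefl _
  exact Subrelation.wf (fun h => Relation.TransGen.single h) h

theorem wellFounded_prec [Finite V] (N : FJQN V) (b : ℕ+) : WellFounded (N.Prec b) := by
  refine Subrelation.wf (r := Prod.Lex (· < ·) N.Arc) ?_
    (WellFounded.prod_lex Nat.lt_wfRel.wf N.wellFounded_arc)
  rintro ⟨n, u⟩ ⟨m, v⟩ h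
  have hb := b.pos
  rcases h with ⟨h1, h2⟩ | ⟨h1, h2⟩ | ⟨h1, h2⟩
  · simp only at h1 h2
    subst h2
    exact Prod.Lex.right _ h1
  · exact Prod.Lex.left _ _ (by simp only at h2 ⊢; omega)
  · exact Prod.Lex.left _ _ (by simp only at h2 ⊢; omega)

/-- Service completion times for given service times `s (m, v)` (`m = 0, 1, 2, …`), all buffers
being empty at time zero: a service starts as soon as all the services it waits for are
completed (at time `sSup ∅ = 0` if there is none). -/
noncomputable def completionTime [Finite V] (N : FJQN V) (b : ℕ+) (s : ℕ × V → ℝ) :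
    ℕ × V → ℝ :=
  (N.wellFounded_prec b).fix fun x T => s x + sSup {t | ∃ y, ∃ h : N.Prec b y x, t = T y h}

/-- The recurrence equation of the completion times. -/
theorem completionTime_eq [Finite V] (N : FJQN V) (b : ℕ+) (s : ℕ × V → ℝ) (m : ℕ) (v : V) :
    N.completionTime b s (m, v) = s (m, v) + sSup (
      {t | ∃ u, N.Arc u v ∧ t = N.completionTime b s (m, u)} ∪
      {t | 1 ≤ m ∧ t = N.completionTime b s (m - 1, v)} ∪
      {t | ∃ w, N.Arc v w ∧ (b : ℕ) ≤ m ∧ t = N.completionTime b s (m - b, w)}) := by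
  conv_lhs => rw [completionTime, WellFounded.fix_eq]
  congr 2
  ext t
  constructor
  · rintro ⟨⟨n, u⟩, h, rfl⟩
    rcases h with ⟨h1, h2⟩ | ⟨h1, h2⟩ | ⟨h1, h2⟩ <;> simp only at h1 h2
    · subst h2
      exact Or.inl (Or.inl ⟨u, h1, rfl⟩)
    · subst h1
      refine Or.inl (Or.inr ⟨by omega, ?_⟩)
      rw [show m - 1 = n by omega]
      rfl
    · refine Or.inr ⟨u, h1, by omega, ?_⟩
      rw [show m - (b : ℕ) = n by omega]
      rfl
  · rintro ((⟨u, h, rfl⟩ | ⟨h, rfl⟩) | ⟨w, h, hm, rfl⟩)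
    · exact ⟨(m, u), Or.inl ⟨h, rfl⟩, rfl⟩
    · exact ⟨(m - 1, v), Or.inr (Or.inl ⟨rfl, by simp only; omega⟩), rfl⟩
    · exact ⟨(m - b, w), Or.inr (Or.inr ⟨h, by simp only; omega⟩), rfl⟩

/-- `θ` is the throughput of the network with random service times `S`: at every node `v` the
limit `L` of `T_{m,v} / m` exists almost surely (in `[0, ∞]`), and `θ` is the expectation
of `1 / L`. -/
def IsThroughput [Finite V] {Ω : Type*} [MeasurableSpace Ω] (N : FJQN V) (b : ℕ+)
    (μ : Measure Ω) (S : ℕ × V → Ω → ℝ) (θ : ℝ≥0∞) : Prop :=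
  ∀ v : V, ∃ L : Ω → ℝ≥0∞,
    (∀ᵐ ω ∂μ, Tendsto
      (fun m : ℕ => ENNReal.ofReal (N.completionTime b (fun p => S p ω) (m, v) / m))
      atTop (𝓝 (L ω))) ∧
    θ = ∫⁻ ω, (L ω)⁻¹ ∂μ

end Network

section Dimension

variable {V : Type*}

/-- The shortest distance between `v` and a node of `W` (`⊤` if `W` is empty). -/
noncomputable def distToSet (G : SimpleGraph V) (v : V) (W : Set V) : ℕ∞ :=
  ⨅ w ∈ W, G.edist v w

/-- The extended metric representation of `v` with respect to `𝓦 = (W₁, …, W_k)`. -/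
noncomputable def extMetricRep (G : SimpleGraph V) {k : ℕ} (𝓦 : Fin k → Set V) (v : V) :
    Fin k → ℕ∞ :=
  fun t => distToSet G v (𝓦 t)

/-- `𝓦` is a `Λ`-extended resolving set for `G`: each representation is shared by at most `Λ`
nodes. -/
def IsExtResolvingSet (G : SimpleGraph V) (Λ : ℕ) {k : ℕ} (𝓦 : Fin k → Set V) : Prop :=
  ∀ v : V, {u : V | extMetricRep G 𝓦 u = extMetricRep G 𝓦 v}.encard ≤ Λ

end Dimension

/-- For one constant `Λ`, each network of the sequence has a `Λ`-extended resolving set of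
cardinality at most `k`. -/
def HasExtResolvingSets {V : ℕ → Type*} (N : ∀ i, FJQN (V i)) (k : ℕ) : Prop :=
  ∃ Λ : ℕ, 0 < Λ ∧ ∀ i, ∃ k' ≤ k, ∃ 𝓦 : Fin k' → Set (V i),
    IsExtResolvingSet (N i).graph Λ 𝓦

/-- The extended metric dimension of a sequence of networks (`⊤` if no `k` works). -/
noncomputable def extMetricDim {V : ℕ → Type*} (N : ∀ i, FJQN (V i)) : ℕ∞ :=
  ⨅ (k : ℕ) (_ : HasExtResolvingSets N k), (k : ℕ∞)

/-- Bounded degrees and minimum levels: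
`limsup D(N_i) < ∞` and `limsup L*(N_i) < ∞`. -/
def DegreeLevelBounded {V : ℕ → Type*} [∀ i, Fintype (V i)] (N : ∀ i, FJQN (V i)) : Prop :=
  limsup (fun i => ((N i).networkDegree : ℕ∞)) atTop < ⊤ ∧
    limsup (fun i => ((N i).minLevel : ℕ∞)) atTop < ⊤

/-- The service times of one network are independent and identically distributed with law `σ`. -/
structure IsIIDService {V Ω : Type*} [MeasurableSpace Ω] (μ : Measure Ω)
    (S : ℕ × V → Ω → ℝ) (σ : Measure ℝ) : Prop where
  measurable : ∀ p, Measurable (S p)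
  map_eq : ∀ p, μ.map (S p) = σ
  indep : iIndepFun S μ

/-- The sequence is throughput scalable: each network `N_i` has a throughput `θ_i`, and
`liminf θ_i > 0`. -/
def ThroughputScalable {V : ℕ → Type*} [∀ i, Finite (V i)] {Ω : ℕ → Type*}
    [∀ i, MeasurableSpace (Ω i)] (N : ∀ i, FJQN (V i)) (b : ℕ+)
    (μ : ∀ i, Measure (Ω i)) (S : ∀ i, ℕ × V i → Ω i → ℝ) : Prop :=
  ∃ θ : ℕ → ℝ≥0∞, (∀ i, (N i).IsThroughput b (μ i) (S i) (θ i)) ∧ 0 < liminf θ atTop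

end FJQN

/-! Unrolling the recurrence writes `T_{m,v}` as the weight of a path in the precedence graph, so
the problem becomes one of last-passage percolation. The services are mapped by `coords` to a
lattice of dimension at most `K`: one coordinate is the job number divided by `b`, the others are
the distances to the resolving sets. A precedence arc moves each coordinate by at most one
(`Prec.coords_le`), and at most `b * Λ` services share a position (`encard_coords_eq_le`). A
topological labelling with increments at most `L` bounds the number of points of a path ending at
job `m` by `(L + 1) * m + R` (`exists_path_length_le`).

It remains to bound the expected maximal weight of self-avoiding Lipschitz paths of `n` points from
a fixed start by a constant times `n`, uniformly over the networks (`exists_greedy_path_bound`). The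
weights are cut into layers `S > j`, of probability `α_j ^ K`. For an event of probability `α ^ K`,
a lattice box of side `1 / α` contains boundedly many occurrences on average. A path of `n` points
follows a chain of about `n * α` boxes, and the number of such chains is only exponential in `n *
α`, so an exponential moment bounds the expected maximal count by a multiple of `n * α`
(`exists_cover_lintegral_le`). Summing over the layers leaves the sum of the `α_j`, which is finite
by the integral condition.

For a single network, the time at which job `m` is complete everywhere is subadditive in `m`, and
superadditive up to a fixed gap. The strong law on disjoint blocks of jobs then gives a
deterministic growth rate `γ`. By Fatou, `γ` inherits the uniform linear bound, and the throughput
is `1 / γ`. -/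

namespace FJQN

/-! ### Completion times as path weights in the precedence graph -/

section CompletionTime

variable {V : Type*}

theorem Prec.fst_le {N : FJQN V} {b : ℕ+} {y x : ℕ × V} (h : N.Prec b y x) : y.1 ≤ x.1 := by
  rcases h with ⟨_, h⟩ | ⟨_, h⟩ | ⟨_, h⟩ <;> omega

theorem Prec.shift {N : FJQN V} {b : ℕ+} {y x : ℕ × V} (h : N.Prec b y x) (n : ℕ) :
    N.Prec b (n + y.1, y.2) (n + x.1, x.2) := by
  rcases h with ⟨h, h'⟩ | ⟨h, h'⟩ | ⟨h, h'⟩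
  · exact Or.inl ⟨h, by simp only; omega⟩
  · exact Or.inr (Or.inl ⟨h, by simp only; omega⟩)
  · exact Or.inr (Or.inr ⟨h, by simp only; omega⟩)

theorem Prec.unshift {N : FJQN V} {b : ℕ+} {n m m' : ℕ} {u v : V}
    (h : N.Prec b (n + m', u) (n + m, v)) : N.Prec b (m', u) (m, v) := by
  rcases h with ⟨h, h'⟩ | ⟨h, h'⟩ | ⟨h, h'⟩ <;> simp only at h h'
  · exact Or.inl ⟨h, by simp only; omega⟩
  · exact Or.inr (Or.inl ⟨h, by simp only; omega⟩)
  · exact Or.inr (Or.inr ⟨h, by simp only; omega⟩)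

theorem prec_succ (N : FJQN V) (b : ℕ+) (m : ℕ) (v : V) : N.Prec b (m, v) (m + 1, v) :=
  Or.inr (Or.inl ⟨rfl, rfl⟩)

variable [Finite V] (N : FJQN V) (b : ℕ+)

theorem finite_prec (x : ℕ × V) : {y | N.Prec b y x}.Finite :=
  ((Set.finite_Iic x.1).prod (Set.finite_univ (α := V))).subset
    fun _ hy => ⟨hy.fst_le, trivial⟩

theorem completionTime_eq_sSup_image (s : ℕ × V → ℝ) (x : ℕ × V) :
    N.completionTime b s x = s x + sSup (N.completionTime b s '' {y | N.Prec b y x}) := by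
  conv_lhs => rw [completionTime, WellFounded.fix_eq]
  congr 2
  ext t
  constructor
  · rintro ⟨y, hy, rfl⟩
    exact ⟨y, hy, rfl⟩
  · rintro ⟨y, hy, rfl⟩
    exact ⟨y, hy, rfl⟩

variable {N b}

theorem Prec.add_completionTime_le {y x : ℕ × V} (h : N.Prec b y x) (s : ℕ × V → ℝ) :
    s x + N.completionTime b s y ≤ N.completionTime b s x := by
  rw [completionTime_eq_sSup_image N b s x]
  gcongr
  exact le_csSup ((N.finite_prec b x).image _).bddAbove ⟨y, h, rfl⟩

variable (N b)

/-- A service has finitely many predecessors, so the supremum in the recurrence is attained; this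
dichotomy drives the inductions below. -/
theorem completionTime_eq_or (s : ℕ × V → ℝ) (x : ℕ × V) :
    N.completionTime b s x = s x ∨
      ∃ y, N.Prec b y x ∧ N.completionTime b s x = s x + N.completionTime b s y := by
  rw [completionTime_eq_sSup_image N b s x]
  rcases Set.eq_empty_or_nonempty {y | N.Prec b y x} with h | h
  · left
    rw [h, Set.image_empty, Real.sSup_empty, add_zero]
  · right
    obtain ⟨y, hy, hy'⟩ := (h.image (N.completionTime b s)).csSup_mem ((N.finite_prec b x).image _)
    exact ⟨y, hy, by rw [hy']⟩

theorem completionTime_nonneg {s : ℕ × V → ℝ} (hs : ∀ p, 0 ≤ s p) (x : ℕ × V) :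
    0 ≤ N.completionTime b s x := by
  induction x using (N.wellFounded_prec b).induction with
  | _ x ih =>
    rcases N.completionTime_eq_or b s x with h | ⟨y, hy, h⟩
    · exact h ▸ hs x
    · rw [h]
      exact add_nonneg (hs x) (ih y hy)

variable {N b} in
theorem Prec.completionTime_le {y x : ℕ × V} (h : N.Prec b y x) {s : ℕ × V → ℝ}
    (hs : ∀ p, 0 ≤ s p) : N.completionTime b s y ≤ N.completionTime b s x := by
  linarith [h.add_completionTime_le s, hs x]

theorem monotone_completionTime {s : ℕ × V → ℝ} (hs : ∀ p, 0 ≤ s p) (v : V) :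
    Monotone fun m => N.completionTime b s (m, v) :=
  monotone_nat_of_le_succ fun m => (N.prec_succ b m v).completionTime_le hs

/-- Completion times up to job `m` depend only on the services up to job `m`. -/
theorem completionTime_congr {s s' : ℕ × V → ℝ} {m : ℕ} (h : ∀ p : ℕ × V, p.1 ≤ m → s p = s' p)
    (x : ℕ × V) (hx : x.1 ≤ m) : N.completionTime b s x = N.completionTime b s' x := by
  induction x using (N.wellFounded_prec b).induction with
  | _ x ih =>
    rw [completionTime_eq_sSup_image, completionTime_eq_sSup_image, h x hx]
    congr 2
    exact Set.image_congr fun y hy => ih y hy ((Prec.fst_le hy).trans hx)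

theorem measurable_completionTime (x : ℕ × V) :
    Measurable fun s : ℕ × V → ℝ => N.completionTime b s x := by
  induction x using (N.wellFounded_prec b).induction with
  | _ x ih =>
    have hfin := N.finite_prec b x
    rcases Set.eq_empty_or_nonempty {y | N.Prec b y x} with h | h
    · have : (fun s : ℕ × V → ℝ => N.completionTime b s x) = fun s => s x := by
        ext s
        rw [completionTime_eq_sSup_image, h, Set.image_empty, Real.sSup_empty, add_zero]
      rw [this]
      exact measurable_pi_apply x
    · have hne : hfin.toFinset.Nonempty := by simpa using h
      have : (fun s : ℕ × V → ℝ => N.completionTime b s x) =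
          fun s => s x + (hfin.toFinset.sup' hne fun y s => N.completionTime b s y) s := by
        ext s
        rw [completionTime_eq_sSup_image, Finset.sup'_apply, Finset.sup'_eq_csSup_image,
          Set.Finite.coe_toFinset]
      rw [this]
      refine (measurable_pi_apply x).add (Finset.measurable_sup' hne fun y hy => ih y ?_)
      simpa using hy

/-- Completion times are weights of paths in the precedence graph. -/
theorem exists_path_completionTime (s : ℕ × V → ℝ) (x : ℕ × V) :
    ∃ (n : ℕ) (π : ℕ → ℕ × V), π 0 = x ∧ (∀ i < n, N.Prec b (π (i + 1)) (π i)) ∧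
      N.completionTime b s x = ∑ i ∈ Finset.range (n + 1), s (π i) := by
  induction x using (N.wellFounded_prec b).induction with
  | _ x ih =>
    rcases N.completionTime_eq_or b s x with h | ⟨y, hy, h⟩
    · exact ⟨0, fun _ => x, rfl, by simp, by simpa using h⟩
    · obtain ⟨n, π, h0, hπ, hsum⟩ := ih y hy
      refine ⟨n + 1, fun i => Nat.casesOn i x π, rfl, ?_, ?_⟩
      · rintro (_ | i) hi
        · simpa [h0] using hy
        · exact hπ i (by omega)
      · rw [Finset.sum_range_succ', h, hsum, add_comm]
        rfl

/-- From any node to any node, information passes within a bounded number of jobs. -/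
theorem exists_completionTime_le_add :
    ∃ c : ℕ, ∀ s : ℕ × V → ℝ, (∀ p, 0 ≤ s p) → ∀ n u v,
      N.completionTime b s (n, u) ≤ N.completionTime b s (n + c, v) := by
  have key : ∀ u v, (w : (SimpleGraph.fromRel N.Arc).Walk u v) → ∃ c : ℕ, ∀ s : ℕ × V → ℝ,
      (∀ p, 0 ≤ s p) → ∀ n, N.completionTime b s (n, u) ≤ N.completionTime b s (n + c, v) := by
    intro u v w
    induction w with
    | nil => exact ⟨0, fun s hs n => le_rfl⟩
    | @cons u u' v h p ih =>
      obtain ⟨c, hc⟩ := ih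
      -- Following an arc forwards costs no job, following it backwards costs `b` jobs through the
      -- blocking constraint; `b` covers both cases.
      refine ⟨b + c, fun s hs n => ?_⟩
      rw [← add_assoc]
      refine le_trans ?_ (hc s hs (n + b))
      rcases h.2 with h | h
      · have h' : N.Prec b (n, u) (n, u') := Or.inl ⟨h, rfl⟩
        exact (h'.completionTime_le hs).trans
          (N.monotone_completionTime b hs u' (Nat.le_add_right n b))
      · exact Prec.completionTime_le (Or.inr (Or.inr ⟨h, rfl⟩)) hs
  choose c hc using fun p : V × V => key p.1 p.2 (N.connected.preconnected p.1 p.2).some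
  obtain ⟨C, hC⟩ := (Set.finite_range c).bddAbove
  refine ⟨C, fun s hs n u v => (hc (u, v) s hs n).trans (N.monotone_completionTime b hs v ?_)⟩
  have := hC ⟨(u, v), rfl⟩
  omega

end CompletionTime

/-! ### Sub- and superadditivity of the time when a job is complete everywhere -/

section MaxCompletionTime

variable {V : Type*} [Fintype V] (N : FJQN V) (b : ℕ+)

/-- The time when the `m`-th job is completed at all nodes. -/
noncomputable def maxCompletionTime (s : ℕ × V → ℝ) (m : ℕ) : ℝ :=
  Finset.univ.sup' (Finset.univ_nonempty_iff.2 N.connected.nonempty)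
    fun v => N.completionTime b s (m, v)

/-- The service times when the first `n` jobs are skipped. -/
def skipJobs (n : ℕ) (s : ℕ × V → ℝ) : ℕ × V → ℝ := fun p => s (n + p.1, p.2)

@[simp]
theorem skipJobs_zero {V : Type*} (s : ℕ × V → ℝ) : skipJobs 0 s = s := by
  ext p
  simp [skipJobs]

theorem completionTime_le_max (s : ℕ × V → ℝ) (m : ℕ) (v : V) :
    N.completionTime b s (m, v) ≤ N.maxCompletionTime b s m :=
  Finset.le_sup' (fun v => N.completionTime b s (m, v)) (Finset.mem_univ v)

theorem maxCompletionTime_le_iff {s : ℕ × V → ℝ} {m : ℕ} {a : ℝ} :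
    N.maxCompletionTime b s m ≤ a ↔ ∀ v, N.completionTime b s (m, v) ≤ a := by
  simp [maxCompletionTime, Finset.sup'_le_iff]

theorem maxCompletionTime_nonneg {s : ℕ × V → ℝ} (hs : ∀ p, 0 ≤ s p) (m : ℕ) :
    0 ≤ N.maxCompletionTime b s m := by
  obtain ⟨v⟩ := N.connected.nonempty
  exact (N.completionTime_nonneg b hs (m, v)).trans (N.completionTime_le_max b s m v)

theorem monotone_maxCompletionTime {s : ℕ × V → ℝ} (hs : ∀ p, 0 ≤ s p) :
    Monotone (N.maxCompletionTime b s) := fun _ n h =>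
  (N.maxCompletionTime_le_iff b).2 fun v =>
    (N.monotone_completionTime b hs v h).trans (N.completionTime_le_max b s n v)

theorem maxCompletionTime_congr {s s' : ℕ × V → ℝ} {m : ℕ}
    (h : ∀ p : ℕ × V, p.1 ≤ m → s p = s' p) :
    N.maxCompletionTime b s m = N.maxCompletionTime b s' m := by
  unfold maxCompletionTime
  congr 1
  ext v
  exact N.completionTime_congr b h (m, v) le_rfl

theorem measurable_maxCompletionTime (m : ℕ) :
    Measurable fun s : ℕ × V → ℝ => N.maxCompletionTime b s m := by
  have := Finset.measurable_sup' (Finset.univ_nonempty_iff.2 N.connected.nonempty)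
    (f := fun v (s : ℕ × V → ℝ) => N.completionTime b s (m, v))
    fun v _ => N.measurable_completionTime b (m, v)
  convert! this using 1
  ext s
  rw [Finset.sup'_apply]
  rfl

/-- Holding all later jobs back until job `n` is complete everywhere only delays them: a predecessor
of a later service is either itself later, or done by then. -/
theorem maxCompletionTime_add_le {s : ℕ × V → ℝ} (hs : ∀ p, 0 ≤ s p) (n m : ℕ) :
    N.maxCompletionTime b s (n + 1 + m) ≤
      N.maxCompletionTime b s n + N.maxCompletionTime b (skipJobs (n + 1) s) m := by
  have key : ∀ x : ℕ × V, N.completionTime b s (n + 1 + x.1, x.2) ≤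
      N.maxCompletionTime b s n + N.completionTime b (skipJobs (n + 1) s) x := by
    intro x
    induction x using (N.wellFounded_prec b).induction with
    | _ x ih =>
      have hskip : skipJobs (n + 1) s x = s (n + 1 + x.1, x.2) := rfl
      have hs' : ∀ p, 0 ≤ skipJobs (n + 1) s p := fun p => hs _
      have hA := N.maxCompletionTime_nonneg b hs n
      have hT : skipJobs (n + 1) s x ≤ N.completionTime b (skipJobs (n + 1) s) x := by
        rcases N.completionTime_eq_or b (skipJobs (n + 1) s) x with h | ⟨y, hy, h⟩
        · exact h.ge
        · linarith [N.completionTime_nonneg b hs' y]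
      rcases N.completionTime_eq_or b s (n + 1 + x.1, x.2) with h | ⟨⟨k, u⟩, hy, h⟩
      · linarith
      · rcases le_or_gt (n + 1) k with hk | hk
        · obtain ⟨k, rfl⟩ := Nat.exists_eq_add_of_le hk
          have hy' : N.Prec b (k, u) x := hy.unshift
          linarith [ih _ hy', hy'.add_completionTime_le (skipJobs (n + 1) s)]
        · have : N.completionTime b s (k, u) ≤ N.maxCompletionTime b s n :=
            (N.completionTime_le_max b s k u).trans
              (N.monotone_maxCompletionTime b hs (by omega))
          linarith
  exact (N.maxCompletionTime_le_iff b).2 fun v =>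
    (key (m, v)).trans (by gcongr; exact N.completionTime_le_max b _ m v)

/-- The reverse inequality needs a gap: after enough further jobs, every node has had to wait for
the slowest completion of job `n`, so the restarted network is uniformly behind. -/
theorem exists_add_le_maxCompletionTime :
    ∃ c : ℕ, 1 ≤ c ∧ (∀ s : ℕ × V → ℝ, (∀ p, 0 ≤ s p) → ∀ n v,
      N.maxCompletionTime b s n ≤ N.completionTime b s (n + c, v)) ∧
      ∀ s : ℕ × V → ℝ, (∀ p, 0 ≤ s p) → ∀ n m,
        N.maxCompletionTime b s n + N.maxCompletionTime b (skipJobs (n + c) s) m ≤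
          N.maxCompletionTime b s (n + c + m) := by
  obtain ⟨c, hc⟩ := N.exists_completionTime_le_add b
  have hmax : ∀ s : ℕ × V → ℝ, (∀ p, 0 ≤ s p) → ∀ n v,
      N.maxCompletionTime b s n ≤ N.completionTime b s (n + c, v) := fun s hs n v =>
    (N.maxCompletionTime_le_iff b).2 fun u => hc s hs n u v
  -- The extra job provides, for each service after the gap, a predecessor at the same node that
  -- already ends after job `n` is complete everywhere.
  refine ⟨c + 1, by omega, fun s hs n v => (hmax s hs n v).trans
    (N.monotone_completionTime b hs v (by omega)), fun s hs n m => ?_⟩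
  have key : ∀ x : ℕ × V, N.maxCompletionTime b s n +
      N.completionTime b (skipJobs (n + (c + 1)) s) x ≤
        N.completionTime b s (n + (c + 1) + x.1, x.2) := by
    intro x
    induction x using (N.wellFounded_prec b).induction with
    | _ x ih =>
      have hskip : skipJobs (n + (c + 1)) s x = s (n + (c + 1) + x.1, x.2) := rfl
      rcases N.completionTime_eq_or b (skipJobs (n + (c + 1)) s) x with h | ⟨y, hy, h⟩
      · have h1 := (N.prec_succ b (n + c + x.1) x.2).add_completionTime_le s
        have h2 := (hmax s hs n x.2).trans
          (N.monotone_completionTime b hs x.2 (by omega : n + c ≤ n + c + x.1))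
        simp only at h2
        rw [show n + c + x.1 + 1 = n + (c + 1) + x.1 by omega] at h1
        linarith
      · linarith [ih y hy, (hy.shift (n + (c + 1))).add_completionTime_le s]
  rw [← le_sub_iff_add_le']
  exact (N.maxCompletionTime_le_iff b).2 fun v => le_sub_iff_add_le'.2
    ((key (m, v)).trans (N.completionTime_le_max b s _ v))

end MaxCompletionTime

/-! ### Strong law along blocks of jobs and the growth rate -/

/-- Cesàro limits along blocks of length `d`. -/
theorem tendsto_sum_range_div {B : ℕ → ℝ} {a : ℝ}
    (h : Tendsto (fun n : ℕ => (∑ j ∈ Finset.range n, B j) / n) atTop (𝓝 a)) {d : ℕ} (hd : 0 < d)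
    (e : ℕ) :
    Tendsto (fun n : ℕ => (∑ j ∈ Finset.range (n / d + e), B j) / n) atTop (𝓝 (a / d)) := by
  have hd' : (0 : ℝ) < d := by exact_mod_cast hd
  have hk : Tendsto (fun n : ℕ => n / d + e) atTop atTop :=
    tendsto_atTop_mono (fun n => Nat.le_add_right _ e) (Nat.tendsto_div_const_atTop hd.ne')
  have hratio : Tendsto (fun n : ℕ => ((n / d + e : ℕ) : ℝ) / n) atTop (𝓝 (1 / d)) := by
    have h1 : Tendsto (fun n : ℕ => 1 / (d : ℝ) + (-1) / (n : ℝ)) atTop (𝓝 (1 / d + 0)) :=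
      tendsto_const_nhds.add (tendsto_const_div_atTop_nhds_zero_nat _)
    have h2 : Tendsto (fun n : ℕ => 1 / (d : ℝ) + e / (n : ℝ)) atTop (𝓝 (1 / d + 0)) :=
      tendsto_const_nhds.add (tendsto_const_div_atTop_nhds_zero_nat _)
    rw [add_zero] at h1 h2
    refine tendsto_of_tendsto_of_tendsto_of_le_of_le' h1 h2 ?_ ?_
    · filter_upwards [eventually_gt_atTop 0] with n hn
      have hn' : (0 : ℝ) < n := by exact_mod_cast hn
      have : (n : ℝ) < d * ((n / d : ℕ) + 1) := by exact_mod_cast Nat.lt_mul_div_succ n hd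
      have h3 : (n : ℝ) / d < (n / d : ℕ) + 1 := by rw [div_lt_iff₀ hd']; linarith
      have : 1 / (d : ℝ) + (-1) / (n : ℝ) = ((n : ℝ) / d - 1) / n := by field_simp; ring
      rw [this]
      push_cast
      gcongr
      have : (0 : ℝ) ≤ e := Nat.cast_nonneg e
      linarith
    · filter_upwards [eventually_gt_atTop 0] with n hn
      have hn' : (0 : ℝ) < n := by exact_mod_cast hn
      have : 1 / (d : ℝ) + e / (n : ℝ) = ((n : ℝ) / d + e) / n := by field_simp
      rw [this]
      push_cast
      gcongr
      exact Nat.cast_div_le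
  have := (h.comp hk).mul hratio
  rw [mul_one_div] at this
  refine this.congr' ?_
  filter_upwards [hk.eventually (eventually_gt_atTop 0)] with n hn
  have hn' : ((n / d + e : ℕ) : ℝ) ≠ 0 := by exact_mod_cast hn.ne'
  simp only [Function.comp_apply]
  field_simp

/-- The joint law is a product of copies of `σ`, hence invariant under the injective shift of job
numbers. -/
theorem IsIIDService.identDistrib_skipJobs {V Ω : Type*} [MeasurableSpace Ω]
    {μ : Measure Ω} {S : ℕ × V → Ω → ℝ} {σ : Measure ℝ} (hS : IsIIDService μ S σ) (n : ℕ) :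
    IdentDistrib (fun ω => skipJobs n fun p => S p ω) (fun ω p => S p ω) μ μ where
  aemeasurable_fst := (measurable_pi_lambda _ fun _ => hS.measurable _).aemeasurable
  aemeasurable_snd := (measurable_pi_lambda _ fun _ => hS.measurable _).aemeasurable
  map_eq := by
    have hinj : Function.Injective fun p : ℕ × V => (n + p.1, p.2) := by
      rintro ⟨m, u⟩ ⟨m', u'⟩ h
      simpa using h
    have h1 := (hS.indep.precomp hinj).map_fun_eq_infinitePi_map fun p => hS.measurable _
    have h2 := hS.indep.map_fun_eq_infinitePi_map hS.measurable
    simp only [hS.map_eq] at h1 h2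
    rw [h2]
    exact h1

theorem IsIIDService.ae_nonneg {V Ω : Type*} [Countable V] [MeasurableSpace Ω]
    {μ : Measure Ω} {S : ℕ × V → Ω → ℝ} {σ : Measure ℝ} (hS : IsIIDService μ S σ)
    (hσ : σ (Set.Iio 0) = 0) : ∀ᵐ ω ∂μ, ∀ p, 0 ≤ S p ω := by
  rw [ae_all_iff]
  intro p
  have : ∀ᵐ x ∂(μ.map (S p)), 0 ≤ x := by
    rw [hS.map_eq, ae_iff]
    simpa only [not_le, Set.Iio] using hσ
  exact ae_of_ae_map (hS.measurable p).aemeasurable this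

variable {V : Type*} [Fintype V] (N : FJQN V) (b : ℕ+)

theorem maxCompletionTime_le_sum {s : ℕ × V → ℝ} (hs : ∀ p, 0 ≤ s p) (M n : ℕ) :
    N.maxCompletionTime b s n ≤ ∑ j ∈ Finset.range (n / (M + 1) + 1),
      N.maxCompletionTime b (skipJobs (j * (M + 1)) s) M := by
  have key : ∀ k, N.maxCompletionTime b s (k * (M + 1) + M) ≤ ∑ j ∈ Finset.range (k + 1),
      N.maxCompletionTime b (skipJobs (j * (M + 1)) s) M := by
    intro k
    induction k with
    | zero => simp
    | succ k ih =>
      rw [Finset.sum_range_succ]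
      have := N.maxCompletionTime_add_le b hs (k * (M + 1) + M) M
      rw [show k * (M + 1) + M + 1 = (k + 1) * (M + 1) by ring] at this
      linarith
  refine (N.monotone_maxCompletionTime b hs ?_).trans (key _)
  have := Nat.lt_mul_div_succ n (Nat.succ_pos M)
  rw [Nat.succ_eq_add_one, mul_comm, add_mul] at this
  omega

/-- Superadditivity is iterated with period `M + c`; the incomplete last period is dropped, whereas
the upper bound by subadditivity rounds it up. -/
theorem sum_le_maxCompletionTime {s : ℕ × V → ℝ} (hs : ∀ p, 0 ≤ s p) {c : ℕ} (hc : 1 ≤ c)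
    (h : ∀ n m, N.maxCompletionTime b s n + N.maxCompletionTime b (skipJobs (n + c) s) m ≤
      N.maxCompletionTime b s (n + c + m)) (M n : ℕ) :
    ∑ j ∈ Finset.range (n / (M + c)), N.maxCompletionTime b (skipJobs (j * (M + c)) s) M ≤
      N.maxCompletionTime b s n := by
  have key : ∀ k, ∑ j ∈ Finset.range (k + 1),
      N.maxCompletionTime b (skipJobs (j * (M + c)) s) M ≤
        N.maxCompletionTime b s (k * (M + c) + M) := by
    intro k
    induction k with
    | zero => simp
    | succ k ih =>
      rw [Finset.sum_range_succ]
      have := h (k * (M + c) + M) M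
      rw [show k * (M + c) + M + c = (k + 1) * (M + c) by ring] at this
      linarith
  have hle := Nat.div_mul_le_self n (M + c)
  rcases hk : n / (M + c) with _ | k
  · simpa using N.maxCompletionTime_nonneg b hs n
  · rw [hk, add_mul] at hle
    exact (key k).trans (N.monotone_maxCompletionTime b hs (by omega))

section Limit

variable {Ω : Type*} [MeasurableSpace Ω] {μ : Measure Ω} {S : ℕ × V → Ω → ℝ} {σ : Measure ℝ}

/-- A block involves only the jobs `j * d, …, j * d + M`, so for `M < d` distinct blocks use
disjoint families of services and the strong law applies. -/
theorem IsIIDService.tendsto_maxCompletionTime_average (hS : IsIIDService μ S σ) {M d : ℕ}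
    (hd : M < d) (hint : Integrable (fun ω => N.maxCompletionTime b (fun p => S p ω) M) μ) :
    ∀ᵐ ω ∂μ, Tendsto (fun n : ℕ => (∑ j ∈ Finset.range n,
      N.maxCompletionTime b (skipJobs (j * d) fun p => S p ω) M) / n) atTop
      (𝓝 (∫ ω, N.maxCompletionTime b (fun p => S p ω) M ∂μ)) := by
  have := strong_law_ae_real (μ := μ)
    (fun j ω => N.maxCompletionTime b (skipJobs (j * d) fun p => S p ω) M) ?_ ?_ ?_
  · simpa only [zero_mul, skipJobs_zero] using this
  · simpa only [zero_mul, skipJobs_zero] using hint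
  · intro j k hjk
    set I : ℕ → Finset (ℕ × V) := fun j => Finset.Icc (j * d) (j * d + M) ×ˢ Finset.univ with hI
    have hdisj : Disjoint (I j) (I k) := by
      rw [Finset.disjoint_left]
      rintro ⟨m, v⟩ h1 h2
      simp only [hI, Finset.mem_product, Finset.mem_Icc, Finset.mem_univ, and_true] at h1 h2
      rcases lt_or_gt_of_ne hjk with h | h
      · have := Nat.mul_le_mul_right d h
        rw [Nat.succ_mul] at this
        omega
      · have := Nat.mul_le_mul_right d h
        rw [Nat.succ_mul] at this
        omega
    classical
    -- Services outside the block are set to `0`, which does not affect the value and makes it a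
    -- function of finitely many coordinates.
    let g : ∀ j, (I j → ℝ) → ℝ := fun j r => N.maxCompletionTime b
      (fun p => if h : (j * d + p.1, p.2) ∈ I j then r ⟨_, h⟩ else 0) M
    have hg : ∀ j, Measurable (g j) := fun j => by
      refine (N.measurable_maxCompletionTime b M).comp (measurable_pi_lambda _ fun p => ?_)
      split_ifs with h
      · exact measurable_pi_apply _
      · exact measurable_const
    have heq : ∀ j, (fun ω => N.maxCompletionTime b (skipJobs (j * d) fun p => S p ω) M) =
        g j ∘ fun ω (i : I j) => S i ω := by
      intro j
      ext ω
      refine N.maxCompletionTime_congr b fun p hp => ?_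
      have : (j * d + p.1, p.2) ∈ I j := by simp [hI, hp]
      simp [skipJobs, this]
    simp only [Function.onFun]
    rw [heq, heq]
    exact (hS.indep.indepFun_finset (I j) (I k) hdisj hS.measurable).comp (hg j) (hg k)
  · intro j
    have h1 := (hS.identDistrib_skipJobs (j * d)).comp (N.measurable_maxCompletionTime b M)
    have h2 := (hS.identDistrib_skipJobs (0 * d)).comp (N.measurable_maxCompletionTime b M)
    exact h1.trans h2.symm

/-- Completion times grow at a deterministic rate, which is the same at all nodes. -/
theorem IsIIDService.exists_tendsto_completionTime_div [IsProbabilityMeasure μ]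
    (hS : IsIIDService μ S σ) (hσ : σ (Set.Iio 0) = 0)
    (hint : ∀ m, Integrable (fun ω => N.maxCompletionTime b (fun p => S p ω) m) μ) :
    ∃ γ : ℝ, ∀ v, ∀ᵐ ω ∂μ, Tendsto
      (fun m : ℕ => N.completionTime b (fun p => S p ω) (m, v) / m) atTop (𝓝 γ) := by
  obtain ⟨c, hc, hmax, hsuper⟩ := N.exists_add_le_maxCompletionTime b
  set a : ℕ → ℝ := fun M => ∫ ω, N.maxCompletionTime b (fun p => S p ω) M ∂μ with ha
  have hup : ∀ᵐ ω ∂μ, ∀ M : ℕ, Tendsto (fun n : ℕ => (∑ j ∈ Finset.range (n / (M + 1) + 1),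
      N.maxCompletionTime b (skipJobs (j * (M + 1)) fun p => S p ω) M) / n) atTop
      (𝓝 (a M / (M + 1 : ℕ))) := by
    rw [ae_all_iff]
    intro M
    filter_upwards [hS.tendsto_maxCompletionTime_average N b (Nat.lt_succ_self M) (hint M)]
      with ω hω
    exact tendsto_sum_range_div hω (Nat.succ_pos M) 1
  have hlow : ∀ᵐ ω ∂μ, ∀ M : ℕ, Tendsto (fun n : ℕ => (∑ j ∈ Finset.range (n / (M + c)),
      N.maxCompletionTime b (skipJobs (j * (M + c)) fun p => S p ω) M) / n) atTop
      (𝓝 (a M / (M + c : ℕ))) := by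
    rw [ae_all_iff]
    intro M
    filter_upwards [hS.tendsto_maxCompletionTime_average N b (by omega : M < M + c) (hint M)]
      with ω hω
    exact tendsto_sum_range_div hω (by omega) 0
  -- Both rates bound the same sequence on a common sample path, so every lower rate is at most
  -- every upper rate.
  have hcomp : ∀ M M' : ℕ, a M / (M + c : ℕ) ≤ a M' / (M' + 1 : ℕ) := by
    intro M M'
    obtain ⟨ω, h1, h2, h3⟩ := (hup.and (hlow.and (hS.ae_nonneg hσ))).exists
    refine le_of_tendsto_of_tendsto' (h2 M) (h1 M') fun n => ?_
    gcongr
    exact (N.sum_le_maxCompletionTime b h3 hc (hsuper _ h3) M n).trans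
      (N.maxCompletionTime_le_sum b h3 M' n)
  have hbdd : BddAbove (Set.range fun M : ℕ => a M / (M + c : ℕ)) :=
    ⟨a 0 / (0 + 1 : ℕ), by rintro _ ⟨M, rfl⟩; exact hcomp M 0⟩
  set γ : ℝ := ⨆ M : ℕ, a M / (M + c : ℕ) with hγ
  -- Upper and lower rates differ only through the period, by a factor `(M + c) / (M + 1)` that
  -- tends to one; hence both pinch `γ`.
  have hub : ∀ M : ℕ, a M / (M + 1 : ℕ) ≤ γ * ((M + c : ℕ) / (M + 1 : ℕ)) := by
    intro M
    have h1 : a M / (M + c : ℕ) ≤ γ := le_ciSup hbdd M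
    have h2 : (0 : ℝ) < (M + c : ℕ) := by exact_mod_cast (by omega : 0 < M + c)
    rw [div_le_iff₀ h2] at h1
    rw [← mul_div_assoc]
    gcongr
  have hratio : Tendsto (fun M : ℕ => γ * (((M + c : ℕ) : ℝ) / (M + 1 : ℕ))) atTop (𝓝 γ) := by
    have h1 : Tendsto (fun M : ℕ => γ * (1 + ((c : ℝ) - 1) * (1 / ((M : ℝ) + 1)))) atTop
        (𝓝 (γ * (1 + (c - 1) * 0))) :=
      ((tendsto_one_div_add_atTop_nhds_zero_nat.const_mul _).const_add _).const_mul _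
    rw [mul_zero, add_zero, mul_one] at h1
    refine h1.congr fun M => ?_
    have : (M : ℝ) + 1 ≠ 0 := by positivity
    push_cast
    field_simp
    ring
  refine ⟨γ, fun v => ?_⟩
  filter_upwards [hup, hlow, hS.ae_nonneg hσ] with ω h1 h2 h3
  have hA : Tendsto (fun n : ℕ => N.maxCompletionTime b (fun p => S p ω) n / n) atTop
      (𝓝 γ) := by
    rw [tendsto_order]
    constructor
    · intro r hr
      obtain ⟨M, hM⟩ := exists_lt_of_lt_ciSup hr
      filter_upwards [(h2 M).eventually (eventually_gt_nhds hM)] with n hn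
      refine hn.trans_le ?_
      gcongr
      exact N.sum_le_maxCompletionTime b h3 hc (hsuper _ h3) M n
    · intro r hr
      obtain ⟨M, hM⟩ := (hratio.eventually (eventually_lt_nhds hr)).exists
      filter_upwards [(h1 M).eventually (eventually_lt_nhds ((hub M).trans_lt hM))] with n hn
      refine lt_of_le_of_lt ?_ hn
      gcongr
      exact N.maxCompletionTime_le_sum b h3 M n
  -- Passage to a single node: its completion time of job `n + c` lies between the maximal ones of
  -- jobs `n` and `n + c`.
  rw [← tendsto_add_atTop_iff_nat c]
  have hA' : Tendsto (fun n : ℕ => N.maxCompletionTime b (fun p => S p ω) n / n *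
      (n / (n + c : ℕ))) atTop (𝓝 (γ * 1)) := by
    refine hA.mul ?_
    simpa using tendsto_natCast_div_add_atTop (c : ℝ)
  rw [mul_one] at hA'
  refine tendsto_of_tendsto_of_tendsto_of_le_of_le' hA'
    ((tendsto_add_atTop_iff_nat c).2 hA) ?_ (Eventually.of_forall fun n => ?_)
  · filter_upwards [eventually_gt_atTop 0] with n hn
    have hn' : (n : ℝ) ≠ 0 := by exact_mod_cast hn.ne'
    rw [div_mul_div_cancel₀ hn']
    gcongr
    exact hmax _ h3 n v
  · gcongr
    exact N.completionTime_le_max b _ _ v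

end Limit

/-! ### Covering Lipschitz paths by chains of boxes -/

/-- A sequence of `n` points with steps of size at most one in every coordinate. -/
def IsLipschitzPath {X ι : Type*} (ψ : X → ι → ℕ) (n : ℕ) (π : ℕ → X) : Prop :=
  ∀ i, i + 1 < n → ∀ t, ψ (π (i + 1)) t ≤ ψ (π i) t + 1 ∧ ψ (π i) t ≤ ψ (π (i + 1)) t + 1

theorem IsLipschitzPath.le_add {X ι : Type*} {ψ : X → ι → ℕ} {n : ℕ} {π : ℕ → X}
    (h : IsLipschitzPath ψ n π) {i : ℕ} (hi : i < n) (t : ι) :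
    ψ (π i) t ≤ ψ (π 0) t + i ∧ ψ (π 0) t ≤ ψ (π i) t + i := by
  induction i with
  | zero => simp
  | succ i ih =>
    have h1 := ih (by omega)
    have h2 := h i hi t
    omega

section Covering

variable {X ι : Type*} [Fintype ι]

open scoped Classical in
/-- The points within distance about `ℓ` of the box with index `B` and side `ℓ`, where `fib a` is
the set of points with coordinates `a`. -/
noncomputable def boxNhd (fib : (ι → ℕ) → Finset X) (ℓ : ℕ) (B : ι → ℕ) : Finset X :=
  (Fintype.piFinset fun t => Finset.Ico ((B t - 1) * ℓ) ((B t + 2) * ℓ)).biUnion fib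

open scoped Classical in
/-- The unions of neighbourhoods of `q` successively adjacent boxes, the first one being `B`. -/
noncomputable def boxChains (fib : (ι → ℕ) → Finset X) (ℓ : ℕ) :
    ℕ → (ι → ℕ) → Finset (Finset X)
  | 0, _ => {∅}
  | q + 1, B => (Fintype.piFinset fun t => Finset.Icc (B t - 1) (B t + 1)).biUnion
      fun B' => (boxChains fib ℓ q B').image (boxNhd fib ℓ B ∪ ·)

variable {fib : (ι → ℕ) → Finset X} {ℓ : ℕ}

theorem card_boxNhd_le {Λ K : ℕ} (hfib : ∀ a, (fib a).card ≤ Λ) (hK : Fintype.card ι ≤ K)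
    (hℓ : 1 ≤ ℓ) (B : ι → ℕ) : (boxNhd fib ℓ B).card ≤ (3 * ℓ) ^ K * Λ := by
  classical
  refine (Finset.card_biUnion_le_card_mul _ _ Λ fun a _ => hfib a).trans ?_
  gcongr
  rw [Fintype.card_piFinset]
  refine (Finset.prod_le_pow_card _ _ (3 * ℓ) fun t _ => ?_).trans ?_
  · rw [Nat.card_Ico, Nat.sub_mul, Nat.add_mul]
    omega
  · rw [Finset.card_univ]
    exact Nat.pow_le_pow_right (by omega) hK

theorem card_boxChains_le {K : ℕ} (hK : Fintype.card ι ≤ K) (q : ℕ) (B : ι → ℕ) :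
    (boxChains fib ℓ q B).card ≤ (3 ^ K) ^ q := by
  classical
  induction q generalizing B with
  | zero => simp [boxChains]
  | succ q ih =>
    rw [boxChains, pow_succ, mul_comm]
    refine (Finset.card_biUnion_le_card_mul _ _ _ fun B' _ =>
      Finset.card_image_le.trans (ih B')).trans ?_
    gcongr
    rw [Fintype.card_piFinset]
    refine (Finset.prod_le_pow_card _ _ 3 fun t _ => ?_).trans ?_
    · rw [Nat.card_Icc]
      omega
    · rw [Finset.card_univ]
      exact Nat.pow_le_pow_right (by omega) hK

theorem card_le_of_mem_boxChains {Λ K : ℕ} (hfib : ∀ a, (fib a).card ≤ Λ)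
    (hK : Fintype.card ι ≤ K) (hℓ : 1 ≤ ℓ) (q : ℕ) (B : ι → ℕ) {U : Finset X}
    (hU : U ∈ boxChains fib ℓ q B) : U.card ≤ q * ((3 * ℓ) ^ K * Λ) := by
  classical
  induction q generalizing B U with
  | zero =>
    rw [boxChains, Finset.mem_singleton] at hU
    simp [hU]
  | succ q ih =>
    rw [boxChains] at hU
    simp only [Finset.mem_biUnion, Finset.mem_image] at hU
    obtain ⟨B', -, U', hU', rfl⟩ := hU
    rw [add_mul, one_mul, add_comm]
    exact (Finset.card_union_le _ _).trans
      (add_le_add (card_boxNhd_le hfib hK hℓ B) (ih B' hU'))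

theorem eq_boxNhd_of_mem_boxChains_one {B : ι → ℕ} {U : Finset X}
    (hU : U ∈ boxChains fib ℓ 1 B) : U = boxNhd fib ℓ B := by
  classical
  simp only [boxChains, Finset.mem_biUnion, Finset.mem_image, Finset.mem_singleton] at hU
  obtain ⟨B', -, U', rfl, rfl⟩ := hU
  simp

theorem boxChains_nonempty (q : ℕ) (B : ι → ℕ) : (boxChains fib ℓ q B).Nonempty := by
  classical
  induction q generalizing B with
  | zero => simp [boxChains]
  | succ q ih =>
    rw [boxChains, Finset.biUnion_nonempty]
    exact ⟨B, by simp [Fintype.mem_piFinset], (ih B).image _⟩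

/-- Within `ℓ` steps no coordinate changes by more than `ℓ`, so this stretch stays near its first
box and the next stretch starts in the same or an adjacent box. -/
theorem IsLipschitzPath.exists_mem_boxChains {ψ : X → ι → ℕ} (hfib : ∀ x, x ∈ fib (ψ x))
    (hℓ : 1 ≤ ℓ) (q : ℕ) {n : ℕ} {π : ℕ → X} (h : IsLipschitzPath ψ n π) (hn : n ≤ q * ℓ) :
    ∃ U ∈ boxChains fib ℓ q (fun t => ψ (π 0) t / ℓ), ∀ i < n, π i ∈ U := by
  classical
  induction q generalizing n π with
  | zero => exact ⟨∅, by simp [boxChains], by omega⟩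
  | succ q ih =>
    have hnear : ∀ i < n, i < ℓ → π i ∈ boxNhd fib ℓ (fun t => ψ (π 0) t / ℓ) := by
      intro i hi hiℓ
      refine Finset.mem_biUnion.2 ⟨ψ (π i), ?_, hfib _⟩
      rw [Fintype.mem_piFinset]
      intro t
      simp only [Finset.mem_Ico, Nat.sub_mul, Nat.add_mul]
      have h1 := h.le_add hi t
      have h2 := Nat.div_add_mod' (ψ (π 0) t) ℓ
      have h3 := Nat.mod_lt (ψ (π 0) t) hℓ
      omega
    rcases le_or_gt n ℓ with hnℓ | hnℓ
    · obtain ⟨U, hU⟩ := boxChains_nonempty (fib := fib) (ℓ := ℓ) q (fun t => ψ (π 0) t / ℓ)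
      refine ⟨boxNhd fib ℓ (fun t => ψ (π 0) t / ℓ) ∪ U, ?_, fun i hi =>
        Finset.mem_union_left _ (hnear i hi (by omega))⟩
      rw [boxChains]
      exact Finset.mem_biUnion.2 ⟨_, by simp [Fintype.mem_piFinset],
        Finset.mem_image_of_mem _ hU⟩
    · have hshift : IsLipschitzPath ψ (n - ℓ) fun i => π (i + ℓ) := by
        intro i hi t
        have := h (i + ℓ) (by omega) t
        rwa [show i + ℓ + 1 = i + 1 + ℓ by omega] at this
      obtain ⟨U, hU, hmem⟩ := ih hshift (by rw [add_mul] at hn; omega)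
      refine ⟨boxNhd fib ℓ (fun t => ψ (π 0) t / ℓ) ∪ U, ?_, fun i hi => ?_⟩
      · rw [boxChains]
        refine Finset.mem_biUnion.2 ⟨_, ?_, Finset.mem_image_of_mem _ hU⟩
        rw [Fintype.mem_piFinset]
        intro t
        have h1 := h.le_add hnℓ t
        have h2 := Nat.div_add_mod' (ψ (π 0) t) ℓ
        have h3 := Nat.mod_lt (ψ (π 0) t) hℓ
        rw [Finset.mem_Icc, zero_add, Nat.le_div_iff_mul_le hℓ, Nat.sub_mul,
          ← Nat.lt_succ_iff (n := _ / ℓ + 1), Nat.div_lt_iff_lt_mul hℓ, Nat.succ_eq_add_one,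
          add_mul, add_mul]
        omega
      · rcases lt_or_ge i ℓ with hi' | hi'
        · exact Finset.mem_union_left _ (hnear i hi hi')
        · have := hmem (i - ℓ) (by omega)
          rw [Nat.sub_add_cancel hi'] at this
          exact Finset.mem_union_right _ this

end Covering

/-! ### Expected maximal weight of greedy paths -/

section Expectation

variable {X Ω : Type*} [MeasurableSpace Ω] {μ : Measure Ω}

/-- Bounds a count by a threshold plus a small multiple of its exponential moment, so that a maximum
can be treated through a sum of exponentials. -/
theorem natCast_le_add_two_pow_mul (h c : ℕ) : (h : ℝ≥0∞) ≤ c + (2 ^ c)⁻¹ * 2 ^ h := by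
  rcases le_total h c with hc | hc
  · exact le_add_right (by exact_mod_cast hc)
  · obtain ⟨k, rfl⟩ := Nat.exists_eq_add_of_le hc
    rw [pow_add, ← mul_assoc, ENNReal.inv_mul_cancel (by simp) (by simp), one_mul]
    push_cast
    gcongr
    exact_mod_cast Nat.lt_two_pow_self.le

/-- The expected maximum, over a finite family of finite sets, of the number of independent
events that occur. -/
theorem lintegral_iSup_sum_indicator_le [IsProbabilityMeasure μ] {E : X → Set Ω}
    (hE : ∀ x, MeasurableSet (E x))
    (hind : iIndepFun (fun x => (E x).indicator (1 : Ω → ℝ≥0∞)) μ) {p : ℝ≥0∞}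
    (hp : ∀ x, μ (E x) = p) (F : Finset (Finset X)) {m c : ℕ} (hm : ∀ U ∈ F, U.card ≤ m)
    (hc : F.card * (1 + p) ^ m ≤ 2 ^ c) :
    ∫⁻ ω, ⨆ U ∈ F, ∑ y ∈ U, (E y).indicator (1 : Ω → ℝ≥0∞) ω ∂μ ≤ c + 1 := by
  classical
  have hmeas : ∀ y, Measurable ((E y).indicator (1 : Ω → ℝ≥0∞)) := fun y =>
    measurable_one.indicator (hE y)
  -- The supremum is dominated by the sum over `F` of `2 ^ count`; as a product of `1 + indicator`,
  -- each term has expectation `(1 + p) ^ U.card` by independence.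
  have hpt : ∀ ω, ⨆ U ∈ F, ∑ y ∈ U, (E y).indicator (1 : Ω → ℝ≥0∞) ω ≤
      c + (2 ^ c)⁻¹ * ∑ U ∈ F, ∏ y ∈ U, (1 + (E y).indicator (1 : Ω → ℝ≥0∞) ω) := by
    intro ω
    refine iSup₂_le fun U hU => ?_
    have h1 : ∑ y ∈ U, (E y).indicator (1 : Ω → ℝ≥0∞) ω =
        ((U.filter fun y => ω ∈ E y).card : ℕ) := by
      simp [Set.indicator_apply]
    have h2 : ∏ y ∈ U, (1 + (E y).indicator (1 : Ω → ℝ≥0∞) ω) =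
        2 ^ (U.filter fun y => ω ∈ E y).card := by
      rw [← Finset.prod_const, Finset.prod_filter]
      refine Finset.prod_congr rfl fun y _ => ?_
      by_cases hy : ω ∈ E y
      · simp [hy, one_add_one_eq_two]
      · simp [hy]
    rw [h1]
    refine (natCast_le_add_two_pow_mul _ c).trans ?_
    gcongr
    rw [← h2]
    exact Finset.single_le_sum (f := fun U : Finset X =>
      ∏ y ∈ U, (1 + (E y).indicator (1 : Ω → ℝ≥0∞) ω)) (fun _ _ => zero_le) hU
  have hind' : iIndepFun (fun x ω => 1 + (E x).indicator (1 : Ω → ℝ≥0∞) ω) μ :=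
    hind.comp (fun _ z => 1 + z) fun _ => measurable_const_add 1
  have hmeas' : ∀ y, Measurable fun ω => 1 + (E y).indicator (1 : Ω → ℝ≥0∞) ω := fun y =>
    measurable_const.add (hmeas y)
  calc ∫⁻ ω, ⨆ U ∈ F, ∑ y ∈ U, (E y).indicator (1 : Ω → ℝ≥0∞) ω ∂μ
      ≤ ∫⁻ ω, c + (2 ^ c)⁻¹ * ∑ U ∈ F, ∏ y ∈ U, (1 + (E y).indicator (1 : Ω → ℝ≥0∞) ω) ∂μ :=
        lintegral_mono hpt
    _ = c + (2 ^ c)⁻¹ * ∑ U ∈ F, (1 + p) ^ U.card := by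
        rw [lintegral_add_left measurable_const, lintegral_const, measure_univ, mul_one,
          lintegral_const_mul _ (Finset.measurable_fun_sum _ fun U _ =>
            Finset.measurable_fun_prod _ fun y _ => hmeas' y),
          lintegral_finsetSum _ fun U _ => Finset.measurable_fun_prod _ fun y _ => hmeas' y]
        congr 3 with U
        rw [lintegral_prod_eq_prod_lintegral_of_indepFun U _ hind' hmeas',
          ← Finset.prod_const]
        refine Finset.prod_congr rfl fun y _ => ?_
        rw [lintegral_add_left measurable_const, lintegral_const, measure_univ, mul_one,
          lintegral_indicator_one (hE y), hp]
    _ ≤ c + (2 ^ c)⁻¹ * (F.card * (1 + p) ^ m) := by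
        gcongr
        rw [← nsmul_eq_mul]
        refine Finset.sum_le_card_nsmul _ _ _ fun U hU => ?_
        exact pow_le_pow_right₀ (by simp) (hm U hU)
    _ ≤ c + (2 ^ c)⁻¹ * 2 ^ c := by gcongr
    _ = c + 1 := by rw [ENNReal.inv_mul_cancel (by simp) (by simp)]

/-- The constant in the bound for greedy paths. -/
def greedyConst (K Λ : ℕ) : ℝ := 4 * (K + Λ * 6 ^ K) + 1

theorem greedyConst_pos (K Λ : ℕ) : 0 < greedyConst K Λ := by
  unfold greedyConst
  positivity

/-- Paths of at most `n` points from a given point are covered by the sets of a finite family such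
that the expected maximal number of events of probability `α ^ K` that occur in one of these sets
is of order at most `n * α`. -/
theorem exists_cover_lintegral_le [IsProbabilityMeasure μ] {ι : Type*} [Fintype ι]
    {ψ : X → ι → ℕ} {K Λ : ℕ} (hK : 1 ≤ K) (hι : Fintype.card ι ≤ K)
    (hψ : ∀ a, {x | ψ x = a}.encard ≤ Λ) {E : X → Set Ω} (hE : ∀ x, MeasurableSet (E x))
    (hind : iIndepFun (fun x => (E x).indicator (1 : Ω → ℝ≥0∞)) μ) {α : ℝ} (hα : 0 ≤ α)
    (hp : ∀ x, μ (E x) = ENNReal.ofReal (α ^ K)) (x : X) {n : ℕ} (hn : 1 ≤ n) :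
    ∃ F : Finset (Finset X),
      (∀ n' ≤ n, ∀ π : ℕ → X, π 0 = x → IsLipschitzPath ψ n' π →
        ∃ U ∈ F, ∀ i < n', π i ∈ U) ∧
      ∫⁻ ω, ⨆ U ∈ F, ∑ y ∈ U, (E y).indicator (1 : Ω → ℝ≥0∞) ω ∂μ ≤
        ENNReal.ofReal (greedyConst K Λ * n * α) := by
  classical
  have hfin : ∀ a, {x | ψ x = a}.Finite := fun a =>
    Set.finite_of_encard_le_coe (hψ a)
  set fib : (ι → ℕ) → Finset X := fun a => (hfin a).toFinset with hfibdef
  have hfib : ∀ x, x ∈ fib (ψ x) := fun x => by simp [hfibdef]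
  have hcard : ∀ a, (fib a).card ≤ Λ := fun a => by
    have := hψ a
    rw [(hfin a).encard_eq_coe_toFinset_card] at this
    exact_mod_cast this
  have hΛ : (0 : ℝ) ≤ Λ := Nat.cast_nonneg Λ
  -- If `n * α < 1`, one box of side `n` suffices: the expected number of events near it is of order
  -- `(n * α) ^ K ≤ n * α`. No chain is needed.
  rcases lt_or_ge (n * α) 1 with hsmall | hlarge
  · refine ⟨boxChains fib n 1 fun t => ψ x t / n, fun n' hn'n π hπ hpath => ?_, ?_⟩
    · subst hπ
      exact hpath.exists_mem_boxChains hfib hn 1 (by omega)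
    · calc ∫⁻ ω, ⨆ U ∈ boxChains fib n 1 fun t => ψ x t / n,
            ∑ y ∈ U, (E y).indicator (1 : Ω → ℝ≥0∞) ω ∂μ
          ≤ ∫⁻ ω, ∑ y ∈ boxNhd fib n fun t => ψ x t / n,
            (E y).indicator (1 : Ω → ℝ≥0∞) ω ∂μ := by
            refine lintegral_mono fun ω => iSup₂_le fun U hU => ?_
            rw [eq_boxNhd_of_mem_boxChains_one hU]
        _ = (boxNhd fib n fun t => ψ x t / n).card * ENNReal.ofReal (α ^ K) := by
            rw [lintegral_finsetSum _ fun y _ => measurable_one.indicator (hE y)]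
            simp [lintegral_indicator_one (hE _), hp]
        _ ≤ ((3 * n) ^ K * Λ : ℕ) * ENNReal.ofReal (α ^ K) := by
            gcongr
            exact card_boxNhd_le hcard hι hn _
        _ ≤ ENNReal.ofReal (greedyConst K Λ * n * α) := by
            rw [← ENNReal.ofReal_natCast, ← ENNReal.ofReal_mul (Nat.cast_nonneg _)]
            refine ENNReal.ofReal_le_ofReal ?_
            have h0 : 0 ≤ n * α := by positivity
            have h1 : (n * α) ^ K ≤ n * α := pow_le_of_le_one h0 hsmall.le (by omega)
            have h2 : (3 : ℝ) ^ K ≤ 6 ^ K := by gcongr; norm_num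
            push_cast
            calc (3 * n : ℝ) ^ K * Λ * α ^ K = 3 ^ K * Λ * (n * α) ^ K := by
                  rw [mul_pow, mul_pow]; ring
              _ ≤ 6 ^ K * Λ * (n * α) := by gcongr
              _ ≤ greedyConst K Λ * (n * α) := by
                  gcongr
                  unfold greedyConst
                  nlinarith [mul_nonneg hΛ (by positivity : (0 : ℝ) ≤ 6 ^ K)]
              _ = greedyConst K Λ * n * α := by ring
  · have hα0 : 0 < α := by
      by_contra h
      have : α = 0 := le_antisymm (not_lt.1 h) hα
      rw [this] at hlarge
      linarith
    have hα1 : α ≤ 1 := by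
      have h1 : ENNReal.ofReal (α ^ K) ≤ 1 := hp x ▸ prob_le_one
      rw [ENNReal.ofReal_le_one] at h1
      exact (pow_le_one_iff_of_nonneg hα (by omega)).1 h1
    -- With this side `1 ≤ ℓ * α ≤ 2`, so a box neighbourhood contains at most `Λ * 6 ^ K` events on
    -- average.
    set ℓ := ⌈1 / α⌉₊ with hℓdef
    have hℓ : 1 ≤ ℓ := Nat.one_le_ceil_iff.2 (by positivity)
    have hℓ1 : 1 ≤ ℓ * α := by
      have := Nat.le_ceil (1 / α)
      rwa [div_le_iff₀ hα0] at this
    have hℓ2 : ℓ * α ≤ 2 := by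
      have := (Nat.ceil_lt_add_one (by positivity : 0 ≤ 1 / α)).le
      have h2 := mul_le_mul_of_nonneg_right this hα
      rw [add_mul, one_div, inv_mul_cancel₀ hα0.ne'] at h2
      rw [hℓdef, one_div]
      linarith
    set q := n / ℓ + 1 with hq
    have hqn : n ≤ q * ℓ := by
      rw [hq, mul_comm]
      exact (Nat.lt_mul_div_succ n hℓ).le
    have hq2 : (q : ℝ) ≤ 2 * (n * α) := by
      have h1 : ((n / ℓ : ℕ) : ℝ) ≤ n / ℓ := Nat.cast_div_le
      have h2 : (n : ℝ) / ℓ ≤ n * α := by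
        rw [div_le_iff₀ (by exact_mod_cast hℓ), mul_assoc]
        exact le_mul_of_one_le_right (by positivity) (by rwa [mul_comm])
      rw [hq]
      push_cast
      linarith
    -- `4 ^ r` bounds the number of chains times the exponential moment. The resulting bound `2 * r
    -- + 1` gives `greedyConst`, since `q ≤ 2 * (n * α)` and `1 ≤ n * α`.
    set r := q * (K + Λ * 6 ^ K) with hr
    refine ⟨boxChains fib ℓ q fun t => ψ x t / ℓ, fun n' hn'n π hπ hpath => ?_, ?_⟩
    · subst hπ
      exact hpath.exists_mem_boxChains hfib hℓ q (by omega)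
    · refine (lintegral_iSup_sum_indicator_le hE hind hp _ (c := 2 * r) (fun U hU =>
        card_le_of_mem_boxChains hcard hι hℓ q _ hU) ?_).trans ?_
      · have h1 : (1 + α ^ K) ^ (q * ((3 * ℓ) ^ K * Λ)) ≤ (4 : ℝ) ^ (q * (Λ * 6 ^ K)) := by
          have h2 : 1 + α ^ K ≤ Real.exp (α ^ K) := by
            rw [add_comm]
            exact Real.add_one_le_exp _
          calc (1 + α ^ K) ^ (q * ((3 * ℓ) ^ K * Λ))
              ≤ Real.exp (α ^ K) ^ (q * ((3 * ℓ) ^ K * Λ)) := by gcongr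
            _ = Real.exp (q * (Λ * (3 * (ℓ * α)) ^ K)) := by
                rw [← Real.exp_nat_mul]
                push_cast
                congr 1
                rw [mul_pow, mul_pow, mul_pow]
                ring
            _ ≤ Real.exp (q * (Λ * (3 * 2) ^ K)) := by gcongr
            _ = Real.exp 1 ^ (q * (Λ * 6 ^ K)) := by
                rw [← Real.exp_nat_mul]
                push_cast
                norm_num
            _ ≤ 4 ^ (q * (Λ * 6 ^ K)) := by
                gcongr
                linarith [Real.exp_one_lt_d9]
        have h2 : ((boxChains fib ℓ q fun t => ψ x t / ℓ).card : ℝ) ≤ 4 ^ (q * K) := by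
          calc ((boxChains fib ℓ q fun t => ψ x t / ℓ).card : ℝ) ≤ (3 ^ K) ^ q := by
                exact_mod_cast card_boxChains_le hι q _
            _ ≤ (4 ^ K) ^ q := by gcongr; norm_num
            _ = 4 ^ (q * K) := by rw [← pow_mul, mul_comm]
        have h3 : ((boxChains fib ℓ q fun t => ψ x t / ℓ).card : ℝ) *
            (1 + α ^ K) ^ (q * ((3 * ℓ) ^ K * Λ)) ≤ 2 ^ (2 * r) := by
          calc _ ≤ (4 : ℝ) ^ (q * K) * 4 ^ (q * (Λ * 6 ^ K)) := by gcongr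
            _ = 2 ^ (2 * r) := by
                rw [← pow_add, pow_mul, hr, mul_add]
                norm_num
        have h4 := ENNReal.ofReal_le_ofReal h3
        rw [ENNReal.ofReal_mul (Nat.cast_nonneg _), ENNReal.ofReal_natCast,
          ENNReal.ofReal_pow (by positivity), ENNReal.ofReal_add zero_le_one (by positivity),
          ENNReal.ofReal_one, ENNReal.ofReal_pow zero_le_two, ENNReal.ofReal_ofNat] at h4
        exact h4
      · rw [← ENNReal.ofReal_natCast, ← ENNReal.ofReal_one,
          ← ENNReal.ofReal_add (Nat.cast_nonneg _) zero_le_one]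
        refine ENNReal.ofReal_le_ofReal ?_
        have h5 : (0 : ℝ) ≤ K + Λ * 6 ^ K := by positivity
        rw [hr]
        push_cast
        unfold greedyConst
        nlinarith [mul_le_mul_of_nonneg_right hq2 h5]

/-- Discrete layer-cake bound: the natural numbers below `s` are counted by `⌈s⌉₊`. -/
theorem ofReal_le_tsum_indicator (s : ℝ) :
    ENNReal.ofReal s ≤ ∑' j : ℕ, (Set.Ioi (j : ℝ)).indicator (1 : ℝ → ℝ≥0∞) s := by
  calc ENNReal.ofReal s ≤ ENNReal.ofReal (⌈s⌉₊ : ℝ) := ENNReal.ofReal_le_ofReal (Nat.le_ceil s)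
    _ = ∑ j ∈ Finset.range ⌈s⌉₊, (Set.Ioi (j : ℝ)).indicator (1 : ℝ → ℝ≥0∞) s := by
        rw [ENNReal.ofReal_natCast, Finset.sum_congr rfl fun j hj => Set.indicator_of_mem
          (Set.mem_Ioi.2 (Nat.lt_ceil.1 (Finset.mem_range.1 hj))) _]
        simp
    _ ≤ _ := ENNReal.sum_le_tsum _

/-- The expected maximal weight of self-avoiding Lipschitz paths of at most `n` points grows at
most linearly in `n`. -/
theorem exists_greedy_path_bound [IsProbabilityMeasure μ] {ι : Type*} [Fintype ι]
    {ψ : X → ι → ℕ} {K Λ : ℕ} (hK : 1 ≤ K) (hι : Fintype.card ι ≤ K)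
    (hψ : ∀ a, {x | ψ x = a}.encard ≤ Λ) {S : X → Ω → ℝ} (hS : ∀ x, Measurable (S x))
    (hind : iIndepFun S μ) {σ : Measure ℝ} (hσ : ∀ x, μ.map (S x) = σ) {α : ℕ → ℝ}
    (hα : ∀ j, 0 ≤ α j) (hp : ∀ j : ℕ, σ (Set.Ioi (j : ℝ)) = ENNReal.ofReal (α j ^ K))
    (hsum : Summable α) (x : X) {n : ℕ} (hn : 1 ≤ n) :
    ∃ g : Ω → ℝ≥0∞,
      (∀ ω, ∀ n' ≤ n, ∀ π : ℕ → X, π 0 = x → IsLipschitzPath ψ n' π →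
        Set.InjOn π (Finset.range n') →
          ENNReal.ofReal (∑ i ∈ Finset.range n', S (π i) ω) ≤ g ω) ∧
      ∫⁻ ω, g ω ∂μ ≤ ENNReal.ofReal (greedyConst K Λ * n * ∑' j, α j) := by
  classical
  set E : ℕ → X → Set Ω := fun j x => S x ⁻¹' Set.Ioi (j : ℝ) with hEdef
  have hE : ∀ j x, MeasurableSet (E j x) := fun j x => hS x measurableSet_Ioi
  have hind' : ∀ j, iIndepFun (fun x => (E j x).indicator (1 : Ω → ℝ≥0∞)) μ := fun j =>
    hind.comp (fun _ => (Set.Ioi (j : ℝ)).indicator 1)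
      fun _ => measurable_one.indicator measurableSet_Ioi
  have hp' : ∀ j x, μ (E j x) = ENNReal.ofReal (α j ^ K) := fun j x => by
    rw [hEdef, ← hp, ← hσ x, Measure.map_apply (hS x) measurableSet_Ioi]
  choose F hF hFint using fun j =>
    exists_cover_lintegral_le hK hι hψ (hE j) (hind' j) (hα j) (hp' j) x hn
  refine ⟨fun ω => ∑' j, ⨆ U ∈ F j, ∑ y ∈ U, (E j y).indicator (1 : Ω → ℝ≥0∞) ω, ?_, ?_⟩
  · intro ω n' hn' π h0 hpath hinj
    calc ENNReal.ofReal (∑ i ∈ Finset.range n', S (π i) ω)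
        ≤ ∑ i ∈ Finset.range n', ENNReal.ofReal (S (π i) ω) :=
          Finset.le_sum_of_subadditive _ ENNReal.ofReal_zero.le
            (fun _ _ => ENNReal.ofReal_add_le) _ _
      _ ≤ ∑ i ∈ Finset.range n', ∑' j, (E j (π i)).indicator (1 : Ω → ℝ≥0∞) ω :=
          Finset.sum_le_sum fun i _ => ofReal_le_tsum_indicator _
      _ = ∑' j, ∑ i ∈ Finset.range n', (E j (π i)).indicator (1 : Ω → ℝ≥0∞) ω :=
          (Summable.tsum_finsetSum fun _ _ => ENNReal.summable).symm
      _ ≤ _ := by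
          refine ENNReal.tsum_le_tsum fun j => ?_
          obtain ⟨U, hU, hmem⟩ := hF j n' hn' π h0 hpath
          refine le_trans ?_ (le_iSup₂ U hU)
          -- Self-avoidance turns the sum along the path into a sum over a subset of the covering
          -- set.
          rw [← Finset.sum_image (f := fun y => (E j y).indicator (1 : Ω → ℝ≥0∞) ω) hinj]
          refine Finset.sum_le_sum_of_subset fun y hy => ?_
          obtain ⟨i, hi, rfl⟩ := Finset.mem_image.1 hy
          exact hmem i (Finset.mem_range.1 hi)
  · rw [lintegral_tsum]
    · rw [← tsum_mul_left, ENNReal.ofReal_tsum_of_nonneg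
        (fun j => mul_nonneg (mul_nonneg (greedyConst_pos K Λ).le (Nat.cast_nonneg n)) (hα j))
        (hsum.mul_left _)]
      exact ENNReal.tsum_le_tsum hFint
    · exact fun j => (Measurable.biSup _ (Finset.countable_toSet _) fun U _ =>
        Finset.measurable_fun_sum _ fun y _ => measurable_one.indicator (hE j y)).aemeasurable

end Expectation

/-! ### Path lengths from topological labellings -/

section Labelling

variable {V : Type*} [Finite V] (N : FJQN V)

/-- The number of strict ancestors increases along arcs, by acyclicity. -/
theorem exists_isTopologicalLabelling : ∃ l : V → ℤ, N.IsTopologicalLabelling l := by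
  refine ⟨fun v => ({u | Relation.TransGen N.Arc u v}.ncard : ℤ), fun u v h => ?_⟩
  have : {w | Relation.TransGen N.Arc w u}.ncard < {w | Relation.TransGen N.Arc w v}.ncard := by
    refine Set.ncard_lt_ncard ⟨fun w hw => hw.tail h, fun hsub => N.acyclic u ?_⟩ (Set.toFinite _)
    exact hsub (Relation.TransGen.single h)
  simp only
  omega

/-- The minimum level is attained. -/
theorem exists_labelling_le_minLevel :
    ∃ l : V → ℤ, N.IsTopologicalLabelling l ∧ ∀ u v, N.Arc u v → l v - l u ≤ N.minLevel := by
  refine Nat.sInf_mem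
    (s := {c : ℕ | ∃ l : V → ℤ, N.IsTopologicalLabelling l ∧ ∀ u v, N.Arc u v → l v - l u ≤ c}) ?_
  obtain ⟨l, hl⟩ := N.exists_isTopologicalLabelling
  obtain ⟨C, hC⟩ := (Set.finite_range fun p : V × V => (l p.2 - l p.1).toNat).bddAbove
  refine ⟨C, l, hl, fun u v _ => ?_⟩
  have := hC ⟨(u, v), rfl⟩
  simp only at this
  omega

/-- Paths in the precedence graph that end at the `m`-th service have at most
`(L + 1) * m + R` nodes, where `L` bounds the increments of a topological labelling, and they are
self-avoiding. -/
theorem exists_path_length_le (b : ℕ+) {L : ℕ} (hL : N.minLevel ≤ L) :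
    ∃ R : ℕ, ∀ (n m : ℕ) (v : V) (π : ℕ → ℕ × V), π 0 = (m, v) →
      (∀ i < n, N.Prec b (π (i + 1)) (π i)) →
        n + 1 ≤ (L + 1) * m + R ∧ Set.InjOn π (Finset.range (n + 1)) := by
  obtain ⟨l, hl1, hl2⟩ := N.exists_labelling_le_minLevel
  obtain ⟨C, hC⟩ := (Set.finite_range fun p : V × V => (l p.2 - l p.1).toNat).bddAbove
  -- The weight `L + 1` on jobs makes `φ` increase by at least one on every arc: a blocking arc
  -- gains at least `L + 1` from the job number and loses at most `L` from the label.
  set φ : ℕ × V → ℤ := fun x => (L + 1) * x.1 + l x.2 with hφ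
  have hstep : ∀ y x, N.Prec b y x → φ y + 1 ≤ φ x := by
    rintro ⟨m, u⟩ ⟨m', v⟩ (⟨h, h'⟩ | ⟨h, h'⟩ | ⟨h, h'⟩) <;> simp only [hφ] at h h' ⊢
    · have := hl1 u v h
      subst h'
      linarith
    · subst h h'
      push_cast
      nlinarith [Int.natCast_nonneg L]
    · have h1 := hl2 v u h
      have h2 : (N.minLevel : ℤ) ≤ L := by exact_mod_cast hL
      have h3 : (1 : ℤ) ≤ (b : ℕ) := by exact_mod_cast b.pos
      subst h'
      push_cast
      nlinarith [Int.natCast_nonneg L]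
  -- `C` bounds the label differences. It depends on the network, but not on `m`, so it disappears
  -- in the growth rate.
  refine ⟨C + 1, fun n m v π h0 hπ => ?_⟩
  have hlt : ∀ k i, i + k ≤ n → φ (π (i + k)) + k ≤ φ (π i) := by
    intro k
    induction k with
    | zero => simp
    | succ k ih =>
      intro i hi
      have h1 := ih i (by omega)
      have h2 := hstep _ _ (hπ (i + k) (by omega))
      rw [← add_assoc]
      push_cast
      linarith
  refine ⟨?_, ?_⟩
  · have h1 := hlt n 0 (by omega)
    have h2 : (l v - l (π n).2).toNat ≤ C := hC ⟨((π n).2, v), rfl⟩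
    rw [zero_add, h0] at h1
    simp only [hφ] at h1
    have h3 : (0 : ℤ) ≤ (L + 1) * (π n).1 := by positivity
    zify
    omega
  · have hne : ∀ i j, i < j → j ≤ n → π i ≠ π j := by
      intro i j hij hj heq
      have := hlt (j - i) i (by omega)
      rw [show i + (j - i) = j by omega, heq] at this
      omega
    intro i hi j hj heq
    have hi' := Finset.mem_range.1 hi
    have hj' := Finset.mem_range.1 hj
    rcases lt_trichotomy i j with h | h | h
    · exact absurd heq (hne i j h (by omega))
    · exact h
    · exact absurd heq.symm (hne j i h (by omega))

end Labelling

/-! ### Lattice coordinates of services -/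

section Coordinates

variable {V : Type*}

theorem distToSet_le_add_one {G : SimpleGraph V} {u v : V} (h : G.Adj u v) (W : Set V) :
    distToSet G u W ≤ distToSet G v W + 1 := by
  by_cases hv : distToSet G v W = ⊤
  · simp [hv]
  · have hlt : distToSet G v W < distToSet G v W + 1 := (ENat.lt_add_one_iff hv).2 le_rfl
    obtain ⟨w, hw, hvw⟩ : ∃ w ∈ W, G.edist v w < distToSet G v W + 1 := by
      simpa only [distToSet, iInf_lt_iff, exists_prop] using hlt
    calc distToSet G u W ≤ G.edist u w := iInf₂_le w hw
      _ ≤ G.edist u v + G.edist v w := G.edist_triangle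
      _ ≤ 1 + distToSet G v W := by
          rw [SimpleGraph.edist_eq_one_iff_adj.2 h]
          gcongr
          exact (ENat.lt_add_one_iff hv).1 hvw
      _ = distToSet G v W + 1 := add_comm _ _

/-- By connectedness, an infinite distance depends only on the set and not on the node, so
truncating distances with `toNat` does not merge different representations. -/
theorem distToSet_eq_top_iff {G : SimpleGraph V} (hG : G.Connected) (v : V) (W : Set V) :
    distToSet G v W = ⊤ ↔ W = ∅ := by
  constructor
  · intro h
    by_contra hW
    obtain ⟨w, hw⟩ := Set.nonempty_iff_ne_empty.2 hW
    have h1 : distToSet G v W ≤ G.edist v w := iInf₂_le w hw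
    rw [h, top_le_iff] at h1
    exact SimpleGraph.edist_ne_top_iff_reachable.2 (hG.preconnected v w) h1
  · rintro rfl
    simp [distToSet]

/-- Coordinates of a service: job number in units of the buffer size, and distances to the sets of
a resolving set. -/
noncomputable def coords (G : SimpleGraph V) (b : ℕ+) {k : ℕ} (𝓦 : Fin k → Set V) (x : ℕ × V) :
    Option (Fin k) → ℕ
  | none => x.1 / b
  | some t => (distToSet G x.2 (𝓦 t)).toNat

theorem Prec.coords_le {N : FJQN V} {b : ℕ+} {y x : ℕ × V} (h : N.Prec b y x) {k : ℕ}
    (𝓦 : Fin k → Set V) (t : Option (Fin k)) :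
    coords N.graph b 𝓦 y t ≤ coords N.graph b 𝓦 x t + 1 ∧
      coords N.graph b 𝓦 x t ≤ coords N.graph b 𝓦 y t + 1 := by
  have hne : ∀ {u v}, N.Arc u v → u ≠ v := fun {u v} h h' =>
    N.acyclic v (.single (by rwa [h'] at h))
  cases t with
  | none =>
    simp only [coords]
    have h1 : y.1 ≤ x.1 := h.fst_le
    -- Dividing job numbers by `b` is what makes a blocking arc, which jumps `b` jobs, a unit step.
    have h2 : x.1 ≤ y.1 + b := by
      have := b.pos
      rcases h with ⟨_, h⟩ | ⟨_, h⟩ | ⟨_, h⟩ <;> omega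
    have h3 := Nat.div_le_div_right (c := (b : ℕ)) h1
    have h4 := Nat.div_le_div_right (c := (b : ℕ)) h2
    rw [Nat.add_div_right _ b.pos] at h4
    omega
  | some t =>
    simp only [coords]
    have key : ∀ {u v}, N.graph.Adj u v → (distToSet N.graph u (𝓦 t)).toNat ≤
        (distToSet N.graph v (𝓦 t)).toNat + 1 := by
      intro u v huv
      by_cases hW : 𝓦 t = ∅
      · have hG : N.graph.Connected := N.connected
        simp [(distToSet_eq_top_iff hG _ _).2 hW]
      · have hv : distToSet N.graph v (𝓦 t) ≠ ⊤ :=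
          mt (distToSet_eq_top_iff N.connected v (𝓦 t)).1 hW
        have := ENat.toNat_le_toNat (distToSet_le_add_one huv (𝓦 t))
          (by simpa using hv)
        rwa [ENat.toNat_add hv ENat.one_ne_top, ENat.toNat_one] at this
    rcases h with ⟨h, _⟩ | ⟨h, _⟩ | ⟨h, _⟩
    · have : N.graph.Adj y.2 x.2 := ⟨hne h, Or.inl h⟩
      exact ⟨key this, key this.symm⟩
    · rw [h]
      omega
    · have : N.graph.Adj x.2 y.2 := ⟨hne h, Or.inl h⟩
      exact ⟨key this.symm, key this⟩

/-- A fibre lies in the product of `b` consecutive job numbers and a class of at most `Λ` nodes with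
equal representation. -/
theorem encard_coords_eq_le {G : SimpleGraph V} (hG : G.Connected) (b : ℕ+) {k Λ : ℕ}
    {𝓦 : Fin k → Set V} (h𝓦 : IsExtResolvingSet G Λ 𝓦) (a : Option (Fin k) → ℕ) :
    {x | coords G b 𝓦 x = a}.encard ≤ (b * Λ : ℕ) := by
  rcases Set.eq_empty_or_nonempty {x | coords G b 𝓦 x = a} with h | ⟨⟨m₀, v₀⟩, h₀⟩
  · simp [h]
  · have hsub : {x | coords G b 𝓦 x = a} ⊆
        (Finset.Ico (a none * b) (a none * b + b) : Set ℕ) ×ˢ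
          {u | extMetricRep G 𝓦 u = extMetricRep G 𝓦 v₀} := by
      rintro ⟨m, v⟩ h
      refine ⟨?_, ?_⟩
      · have h1 : m / b = a none := congrFun h none
        rw [Finset.coe_Ico, Set.mem_Ico, ← h1]
        have := Nat.div_add_mod' m b
        have := Nat.mod_lt m b.pos
        simp only
        omega
      · ext t
        have h1 : (distToSet G v (𝓦 t)).toNat = (distToSet G v₀ (𝓦 t)).toNat :=
          (congrFun h (some t)).trans (congrFun h₀ (some t)).symm
        simp only [extMetricRep]
        by_cases hW : 𝓦 t = ∅
        · rw [(distToSet_eq_top_iff hG _ _).2 hW, (distToSet_eq_top_iff hG _ _).2 hW]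
        · rw [← ENat.natCast_toNat (mt (distToSet_eq_top_iff hG v (𝓦 t)).1 hW), h1,
            ENat.natCast_toNat (mt (distToSet_eq_top_iff hG v₀ (𝓦 t)).1 hW)]
    refine (Set.encard_le_encard hsub).trans ?_
    rw [Set.encard_prod, Set.encard_coe_eq_coe_finsetCard, Nat.card_Ico, Nat.add_sub_cancel_left,
      Nat.cast_mul]
    exact mul_le_mul_right (h𝓦 v₀) _

end Coordinates

/-! ### Uniform bound on the growth rate and conclusion -/

/-- The expected completion times grow linearly, with constants that depend only on the level, the
resolving set, the buffer size, and the law of the service times. -/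
theorem IsIIDService.exists_lintegral_completionTime_le {V Ω : Type*} [Finite V]
    [MeasurableSpace Ω] {μ : Measure Ω} [IsProbabilityMeasure μ] {S : ℕ × V → Ω → ℝ}
    {σ : Measure ℝ} (hS : IsIIDService μ S σ) (N : FJQN V) (b : ℕ+) {K Λ k L : ℕ}
    (hk : k + 1 ≤ K) {𝓦 : Fin k → Set V} (h𝓦 : IsExtResolvingSet N.graph Λ 𝓦)
    (hL : N.minLevel ≤ L) {α : ℕ → ℝ} (hα : ∀ j, 0 ≤ α j)
    (hp : ∀ j : ℕ, σ (Set.Ioi (j : ℝ)) = ENNReal.ofReal (α j ^ K)) (hsum : Summable α) :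
    ∃ R : ℕ, ∀ m v, ∫⁻ ω, ENNReal.ofReal (N.completionTime b (fun p => S p ω) (m, v)) ∂μ ≤
      ENNReal.ofReal (greedyConst K (b * Λ) * ((L + 1) * m + R : ℕ) * ∑' j, α j) := by
  obtain ⟨R, hR⟩ := N.exists_path_length_le b hL
  refine ⟨R, fun m v => ?_⟩
  have hn : 1 ≤ (L + 1) * m + R := by
    have := (hR 0 m v (fun _ => (m, v)) rfl (by simp)).1
    omega
  obtain ⟨g, hg, hgint⟩ := exists_greedy_path_bound (μ := μ) (ψ := coords N.graph b 𝓦)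
    (by omega : 1 ≤ K) (by simpa using hk) (encard_coords_eq_le N.connected b h𝓦) hS.measurable
    hS.indep hS.map_eq hα hp hsum (m, v) hn
  refine (lintegral_mono fun ω => ?_).trans hgint
  obtain ⟨n, π, h0, hπ, hT⟩ := N.exists_path_completionTime b (fun p => S p ω) (m, v)
  obtain ⟨hlen, hinj⟩ := hR n m v π h0 hπ
  rw [hT]
  exact hg ω (n + 1) hlen π h0 (fun i hi t => (hπ i (by omega)).coords_le 𝓦 t) hinj

/-- The limit of `T_{m,v} / m` exists almost surely; it is deterministic, does not depend on the
node, and is bounded by a constant that depends only on the level, the resolving set, the buffer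
size, and the law of the service times. -/
theorem IsIIDService.exists_isThroughput {V Ω : Type*} [Fintype V]
    [MeasurableSpace Ω] {μ : Measure Ω} [IsProbabilityMeasure μ] {S : ℕ × V → Ω → ℝ}
    {σ : Measure ℝ} (hS : IsIIDService μ S σ) (hσ : σ (Set.Iio 0) = 0) (N : FJQN V) (b : ℕ+)
    {K Λ k L : ℕ} (hk : k + 1 ≤ K) {𝓦 : Fin k → Set V} (h𝓦 : IsExtResolvingSet N.graph Λ 𝓦)
    (hL : N.minLevel ≤ L) {α : ℕ → ℝ} (hα : ∀ j, 0 ≤ α j)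
    (hp : ∀ j : ℕ, σ (Set.Ioi (j : ℝ)) = ENNReal.ofReal (α j ^ K)) (hsum : Summable α) :
    ∃ θ, N.IsThroughput b μ S θ ∧
      (ENNReal.ofReal (greedyConst K (b * Λ) * (L + 1) * ∑' j, α j))⁻¹ ≤ θ := by
  obtain ⟨R, hR⟩ := hS.exists_lintegral_completionTime_le N b hk h𝓦 hL hα hp hsum
  have hnonneg := hS.ae_nonneg hσ
  have hmeas : ∀ x, Measurable fun ω => N.completionTime b (fun p => S p ω) x := fun x =>
    (N.measurable_completionTime b x).comp (measurable_pi_lambda _ hS.measurable)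
  have hTint : ∀ m v, Integrable (fun ω => N.completionTime b (fun p => S p ω) (m, v)) μ :=
    fun m v => ⟨(hmeas _).aestronglyMeasurable, by
      rw [hasFiniteIntegral_iff_ofReal]
      · exact (hR m v).trans_lt ENNReal.ofReal_lt_top
      · filter_upwards [hnonneg] with ω hω using N.completionTime_nonneg b hω _⟩
  have hAint : ∀ m, Integrable (fun ω => N.maxCompletionTime b (fun p => S p ω) m) μ := by
    intro m
    -- The crude bound by the sum over the nodes serves integrability only, so its dependence on the
    -- network size is harmless.
    refine (integrable_finsetSum Finset.univ fun v _ => hTint m v).mono'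
      ((N.measurable_maxCompletionTime b m).comp
        (measurable_pi_lambda _ hS.measurable)).aestronglyMeasurable ?_
    filter_upwards [hnonneg] with ω hω
    rw [Real.norm_of_nonneg (N.maxCompletionTime_nonneg b hω m)]
    exact (N.maxCompletionTime_le_iff b).2 fun v =>
      Finset.single_le_sum (f := fun v => N.completionTime b (fun p => S p ω) (m, v))
        (fun v _ => N.completionTime_nonneg b hω _) (Finset.mem_univ v)
  obtain ⟨γ, hγ⟩ := hS.exists_tendsto_completionTime_div N b hσ hAint
  have hγ' : ∀ v, ∀ᵐ ω ∂μ, Tendsto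
      (fun m : ℕ => ENNReal.ofReal (N.completionTime b (fun p => S p ω) (m, v) / m))
      atTop (𝓝 (ENNReal.ofReal γ)) := fun v => by
    filter_upwards [hγ v] with ω hω using ENNReal.tendsto_ofReal hω
  refine ⟨(ENNReal.ofReal γ)⁻¹, fun v => ⟨fun _ => ENNReal.ofReal γ, hγ' v, by simp⟩, ?_⟩
  rw [ENNReal.inv_le_inv]
  obtain ⟨v⟩ := N.connected.nonempty
  set C := greedyConst K (b * Λ) with hC
  set Q := ∑' j, α j with hQ
  have hbound : ∀ᶠ m : ℕ in atTop,
      ∫⁻ ω, ENNReal.ofReal (N.completionTime b (fun p => S p ω) (m, v) / m) ∂μ ≤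
        ENNReal.ofReal (C * (L + 1) * Q + C * R * Q / m) := by
    filter_upwards [eventually_gt_atTop 0] with m hm
    have hm' : (0 : ℝ) < m := by exact_mod_cast hm
    simp only [div_eq_mul_inv, ENNReal.ofReal_mul' (inv_nonneg.2 hm'.le)]
    rw [lintegral_mul_const _ (hmeas _).ennreal_ofReal]
    refine (mul_le_mul_left (hR m v) _).trans_eq ?_
    rw [← ENNReal.ofReal_mul' (by positivity)]
    congr 1
    push_cast
    field_simp
  have hlim : Tendsto (fun m : ℕ => ENNReal.ofReal (C * (L + 1) * Q + C * R * Q / m)) atTop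
      (𝓝 (ENNReal.ofReal (C * (L + 1) * Q))) := by
    refine ENNReal.tendsto_ofReal ?_
    simpa using (tendsto_const_div_atTop_nhds_zero_nat (C * R * Q)).const_add (C * (L + 1) * Q)
  -- Fatou's lemma bounds `γ` by the limit of the expectations, where the network-dependent term
  -- with `R` vanishes.
  calc ENNReal.ofReal γ = ∫⁻ _, ENNReal.ofReal γ ∂μ := by simp
    _ = ∫⁻ ω, liminf (fun m : ℕ =>
          ENNReal.ofReal (N.completionTime b (fun p => S p ω) (m, v) / m)) atTop ∂μ := by
        refine lintegral_congr_ae ?_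
        filter_upwards [hγ' v] with ω hω using hω.liminf_eq.symm
    _ ≤ liminf (fun m : ℕ =>
          ∫⁻ ω, ENNReal.ofReal (N.completionTime b (fun p => S p ω) (m, v) / m) ∂μ) atTop :=
        lintegral_liminf_le fun m => ((hmeas _).div_const _).ennreal_ofReal
    _ ≤ liminf (fun m : ℕ => ENNReal.ofReal (C * (L + 1) * Q + C * R * Q / m)) atTop :=
        liminf_le_liminf hbound
    _ = ENNReal.ofReal (C * (L + 1) * Q) := hlim.liminf_eq

theorem exists_hasExtResolvingSets_le {V : ℕ → Type*} {N : ∀ i, FJQN (V i)} {d : ℕ}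
    (h : extMetricDim N ≤ d) : ∃ k ≤ d, HasExtResolvingSets N k := by
  by_contra! hcon
  have : ((d + 1 : ℕ) : ℕ∞) ≤ extMetricDim N := by
    refine le_iInf₂ fun k hk => ?_
    by_contra! hlt
    exact hcon k (by have : k < d + 1 := (by exact_mod_cast hlt); omega) hk
  have := this.trans h
  norm_cast at this
  omega

theorem exists_eventually_le_of_limsup_lt_top {u : ℕ → ℕ}
    (h : limsup (fun i => (u i : ℕ∞)) atTop < ⊤) : ∃ L, ∀ᶠ i in atTop, u i ≤ L := by
  obtain ⟨L, hL⟩ := ENat.ne_top_iff_exists.1 h.ne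
  refine ⟨L, ?_⟩
  have : limsup (fun i => (u i : ℕ∞)) atTop < ((L + 1 : ℕ) : ℕ∞) := by
    rw [← hL]
    exact_mod_cast Nat.lt_succ_self L
  filter_upwards [eventually_lt_of_limsup_lt this] with i hi
  have : u i < L + 1 := by exact_mod_cast hi
  omega

/-- The `K`-th roots of the tails at the integers are summable. -/
theorem summable_rpow_tail {σ : Measure ℝ} [IsProbabilityMeasure σ] {K : ℕ}
    (hσK : IntegrableOn (fun x : ℝ => (1 - cdf σ x) ^ (1 / (K : ℝ))) (Set.Ioi 0)) :
    Summable fun j : ℕ => (1 - cdf σ (j : ℝ)) ^ (1 / (K : ℝ)) := by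
  set f : ℝ → ℝ := fun x => (1 - cdf σ x) ^ (1 / (K : ℝ)) with hf
  have h0 : ∀ x, 0 ≤ 1 - cdf σ x := fun x => sub_nonneg.2 (cdf_le_one σ x)
  have hf0 : ∀ x, 0 ≤ f x := fun x => Real.rpow_nonneg (h0 x) _
  have hanti : Antitone f := fun x y hxy =>
    Real.rpow_le_rpow (h0 y) (sub_le_sub_left (monotone_cdf σ hxy) 1) (by positivity)
  -- The term at `0` is split off: for an antitone function the integral over `(0, ∞)` dominates the
  -- sum of the values at `1, 2, …`.
  rw [← summable_nat_add_iff 1]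
  refine summable_of_sum_range_le (c := ∫ x in Set.Ioi 0, f x) (fun j => hf0 _) fun n => ?_
  have h1 := (hanti.antitoneOn (Set.Icc 0 (0 + (n : ℝ)))).sum_le_integral
  simp only [zero_add] at h1
  refine h1.trans ?_
  rw [intervalIntegral.integral_of_le (Nat.cast_nonneg n)]
  exact setIntegral_mono_set hσK (Eventually.of_forall hf0)
    (Set.Ioc_subset_Ioi_self.eventuallyLE)

theorem measure_Ioi_eq_ofReal_rpow_pow {σ : Measure ℝ} [IsProbabilityMeasure σ] {K : ℕ}
    (hK : K ≠ 0) (x : ℝ) :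
    σ (Set.Ioi x) = ENNReal.ofReal (((1 - cdf σ x) ^ (1 / (K : ℝ))) ^ K) := by
  rw [one_div, Real.rpow_inv_natCast_pow (sub_nonneg.2 (cdf_le_one σ x)) hK, cdf_eq_real,
    ← probReal_compl_eq_one_sub measurableSet_Iic, Set.compl_Iic, ofReal_measureReal]

end FJQN

theorem theorem3 {V : ℕ → Type*} [∀ i, Fintype (V i)] (N : ∀ i, FJQN (V i))
    (hV : limsup (fun i => (Fintype.card (V i) : ℕ∞)) atTop = ⊤)
    (hN : FJQN.DegreeLevelBounded N)
    (b : ℕ+)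
    (σ : Measure ℝ) [IsProbabilityMeasure σ] (hσ : σ (Set.Iio 0) = 0)
    {Ω : ℕ → Type*} [∀ i, MeasurableSpace (Ω i)]
    (μ : ∀ i, Measure (Ω i)) [∀ i, IsProbabilityMeasure (μ i)]
    (S : ∀ i, ℕ × V i → Ω i → ℝ)
    (hS : ∀ i, FJQN.IsIIDService (μ i) (S i) σ)
    (K : ℕ) (hK : 1 ≤ K)
    (hσK : IntegrableOn (fun x : ℝ => (1 - cdf σ x) ^ (1 / (K : ℝ))) (Set.Ioi 0))
    (hdim : FJQN.extMetricDim N ≤ ((K - 1 : ℕ) : ℕ∞)) :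
    FJQN.ThroughputScalable N b μ S := by
  obtain ⟨d, hd, Λ, -, hΛ⟩ := FJQN.exists_hasExtResolvingSets_le hdim
  obtain ⟨L, hL⟩ := FJQN.exists_eventually_le_of_limsup_lt_top hN.2
  choose k hk 𝓦 h𝓦 using hΛ
  have hroot : ∀ j : ℕ, 0 ≤ (1 - cdf σ (j : ℝ)) ^ (1 / (K : ℝ)) := fun j =>
    Real.rpow_nonneg (sub_nonneg.2 (cdf_le_one σ _)) _
  -- The level `max (N i).minLevel L` gives a throughput also for networks whose level exceeds `L`;
  -- eventually the maximum is `L` and the lower bound is uniform.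
  choose θ hθ hθle using fun i => (hS i).exists_isThroughput hσ (N i) b
    (by have := hk i; omega : k i + 1 ≤ K) (h𝓦 i) (le_max_left (N i).minLevel L) hroot
    (fun j => FJQN.measure_Ioi_eq_ofReal_rpow_pow (by omega) _) (FJQN.summable_rpow_tail hσK)
  refine ⟨θ, hθ, ?_⟩
  set C := FJQN.greedyConst K (b * Λ) * (L + 1) *
    ∑' j : ℕ, (1 - cdf σ (j : ℝ)) ^ (1 / (K : ℝ)) with hC
  refine (ENNReal.inv_pos.2 (ENNReal.ofReal_ne_top (r := C))).trans_le
    (le_liminf_of_le (by isBoundedDefault) ?_)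
  filter_upwards [hL] with i hi
  have := hθle i
  rwa [max_eq_right hi] at this
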